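/- Let $n\ge 1$, let $\Omega\subset\mathbb R^n$ be a bounded open set with $C^2$-smooth boundary (near each boundary point, $\Omega$ is the set $\{r<0\}$ for some real $C^2$ function $r$ with $\nabla r\neq 0$), and let $d(x)=\operatorname{dist}(x,\partial\Omega)$ for $x\in\Omega$. Say that $G:(0,\infty)\to\mathbb R$ satisfies condition $(\Sigma)$ if $G\in C^1(0,\infty)$ and there exists $d_0>0$ such that 1. $0\le G'(t)\le \frac1t$ for $t\in(0,d_0)$ and $G'(t)=0$ for $t\ge d_0$; 2. for every $0<\rho_0\le \frac{d_0}{2}$, $\displaystyle\sum_{k=1}^\infty 4^{-k}e^{-2G(2^{-k}\rho_0)}=\infty$. Let $V\in L^\infty_{\mathrm{loc}}(\Omega)$ be real-valued and suppose that there exist a function $G$ satisfying condition $(\Sigma)$ and real-valued functions $V_1,V_2$ with $V=V_1+V_2$ such that $V_2\in L^\infty(\Omega)$ and $$V_1(x)+\frac14\cdot\frac1{d(x)^2}\ \ge\ G'(d(x))^2\qquad\text{for almost every }x\in\Omega.$$ Then the Schrödinger operator $H=-\Delta+V$ with domain $\mathcal D(H)=C_0^\infty(\Omega)$ is essentially self-adjoint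 in the complex Hilbert space $L^2(\Omega)$; that is, $H$ is densely defined and symmetric, and its closure is self-adjoint. -/

import Mathlib

open MeasureTheory Set Filter TopologicalSpace
open scoped Distributions ENNReal Topology

/-- An open set `Ω ⊆ ℝⁿ` has `C²`-smooth boundary: near each boundary point it is the sublevel set
`{r < 0}` of a real-valued `C²` function `r` without critical points. -/
def HasC2Boundary {n : ℕ} (Ω : Opens (EuclideanSpace ℝ (Fin n))) : Prop :=
  ∀ x₀ ∈ frontier (Ω : Set (EuclideanSpace ℝ (Fin n))),
    ∃ (U : Set (EuclideanSpace ℝ (Fin n))) (r : EuclideanSpace ℝ (Fin n) → ℝ),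
      IsOpen U ∧ x₀ ∈ U ∧ ContDiffOn ℝ 2 r U ∧ (∀ x ∈ U, fderiv ℝ r x ≠ 0) ∧
        (Ω : Set (EuclideanSpace ℝ (Fin n))) ∩ U = {x | x ∈ U ∧ r x < 0}

/-- The Euclidean distance to the boundary of `Ω`. -/
noncomputable def bdryDist {n : ℕ} (Ω : Opens (EuclideanSpace ℝ (Fin n)))
    (x : EuclideanSpace ℝ (Fin n)) : ℝ :=
  Metric.infDist x (frontier (Ω : Set (EuclideanSpace ℝ (Fin n))))

/-- Condition (Σ) on a function `G` on `(0, ∞)`; only the values of `G` on `(0, ∞)` matter. -/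
def ConditionSigma (G : ℝ → ℝ) : Prop :=
  ContDiffOn ℝ 1 G (Ioi 0) ∧
    ∃ d₀ : ℝ, 0 < d₀ ∧
      (∀ t, 0 < t → t < d₀ → 0 ≤ deriv G t ∧ deriv G t ≤ 1 / t) ∧
      (∀ t, d₀ ≤ t → deriv G t = 0) ∧
      ∀ ρ₀, 0 < ρ₀ → ρ₀ ≤ d₀ / 2 →
        Tendsto
          (fun N : ℕ => ∑ k ∈ Finset.Icc 1 N,
            ((4 : ℝ) ^ k)⁻¹ * Real.exp (-2 * G (((2 : ℝ) ^ k)⁻¹ * ρ₀)))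
          atTop atTop

/-- `V ∈ L^∞_loc(Ω)`: measurable and essentially bounded on every compact subset of `Ω`. -/
def LocallyLInfty {n : ℕ} (Ω : Opens (EuclideanSpace ℝ (Fin n)))
    (V : EuclideanSpace ℝ (Fin n) → ℝ) : Prop :=
  ∀ K : Set (EuclideanSpace ℝ (Fin n)), IsCompact K → K ⊆ (Ω : Set (EuclideanSpace ℝ (Fin n))) →
    MemLp V ∞ (volume.restrict K)

/-- The complex Hilbert space `L²(Ω)`. -/
noncomputable abbrev L2 {n : ℕ} (Ω : Opens (EuclideanSpace ℝ (Fin n))) : Type :=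
  Lp ℂ 2 (volume.restrict (Ω : Set (EuclideanSpace ℝ (Fin n))))

/-- The function `-Δφ + Vφ`. -/
noncomputable def schrodingerFun {n : ℕ} (V : EuclideanSpace ℝ (Fin n) → ℝ)
    (φ : EuclideanSpace ℝ (Fin n) → ℂ) (x : EuclideanSpace ℝ (Fin n)) : ℂ :=
  -(Laplacian.laplacian φ x) + (V x : ℂ) * φ x

section

variable {n : ℕ} {Ω : Opens (EuclideanSpace ℝ (Fin n))}

theorem testFunction_memLp (φ : 𝓓(Ω, ℂ)) :
    MemLp φ 2 (volume.restrict (Ω : Set (EuclideanSpace ℝ (Fin n)))) :=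
  φ.continuous.memLp_of_hasCompactSupport φ.hasCompactSupport

theorem testFunction_contDiffAt (φ : 𝓓(Ω, ℂ)) (x : EuclideanSpace ℝ (Fin n)) :
    ContDiffAt ℝ 2 φ x :=
  (φ.contDiff.of_le (WithTop.coe_le_coe.2 (le_top : (2 : ℕ∞) ≤ ⊤))).contDiffAt

theorem testFunction_laplacian_eq (φ : 𝓓(Ω, ℂ)) :
    Laplacian.laplacian (φ : EuclideanSpace ℝ (Fin n) → ℂ) =
      fun x => ∑ i, iteratedFDeriv ℝ 2 φ x
        ![EuclideanSpace.basisFun (Fin n) ℝ i, EuclideanSpace.basisFun (Fin n) ℝ i] :=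
  InnerProductSpace.laplacian_eq_iteratedFDeriv_orthonormalBasis _ _

theorem testFunction_laplacian_memLp (φ : 𝓓(Ω, ℂ)) :
    MemLp (Laplacian.laplacian (φ : EuclideanSpace ℝ (Fin n) → ℂ)) 2
      (volume.restrict (Ω : Set (EuclideanSpace ℝ (Fin n)))) := by
  have hc : Continuous (Laplacian.laplacian (φ : EuclideanSpace ℝ (Fin n) → ℂ)) := by
    rw [testFunction_laplacian_eq]
    refine continuous_finsetSum _ fun i _ => ?_
    have h : Continuous (iteratedFDeriv ℝ 2 φ) :=
      φ.contDiff.continuous_iteratedFDeriv (m := 2) (WithTop.coe_le_coe.2 (le_top : (2 : ℕ∞) ≤ ⊤))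
    exact h.eval_const _
  refine hc.memLp_of_hasCompactSupport ?_
  have hs : HasCompactSupport (iteratedFDeriv ℝ 2 φ) := φ.hasCompactSupport.iteratedFDeriv 2
  refine hs.mono fun x hx => ?_
  contrapose! hx
  simp only [Function.mem_support, not_not] at hx ⊢
  rw [testFunction_laplacian_eq]
  simp [hx]

theorem schrodingerFun_memLp {V : EuclideanSpace ℝ (Fin n) → ℝ} (hV : LocallyLInfty Ω V)
    (φ : 𝓓(Ω, ℂ)) :
    MemLp (schrodingerFun V φ) 2 (volume.restrict (Ω : Set (EuclideanSpace ℝ (Fin n)))) := by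
  refine (testFunction_laplacian_memLp φ).neg.add ?_
  have hK := hV (tsupport φ) φ.hasCompactSupport φ.tsupport_subset
  have hφ : MemLp φ 2 (volume.restrict (tsupport φ)) :=
    φ.continuous.memLp_of_hasCompactSupport φ.hasCompactSupport
  have h : MemLp (fun x => (V x : ℂ) * φ x) 2 (volume.restrict (tsupport φ)) :=
    hφ.mul hK.ofReal
  have hm : MeasurableSet (tsupport φ) := (isClosed_tsupport _).measurableSet
  rw [← memLp_indicator_iff_restrict hm] at h
  have he : (tsupport φ).indicator (fun x => (V x : ℂ) * φ x) = fun x => (V x : ℂ) * φ x := by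
    rw [indicator_eq_self]
    intro x hx
    refine subset_tsupport _ ?_
    simp only [Function.mem_support] at hx ⊢
    exact right_ne_zero_of_mul hx
  rw [he] at h
  exact h.restrict _

/-- The inclusion `C₀^∞(Ω) → L²(Ω)`. -/
noncomputable def testToL2 (Ω : Opens (EuclideanSpace ℝ (Fin n))) : 𝓓(Ω, ℂ) →ₗ[ℂ] L2 Ω where
  toFun φ := (testFunction_memLp φ).toLp φ
  map_add' _ _ := rfl
  map_smul' _ _ := rfl

theorem testToL2_injective (Ω : Opens (EuclideanSpace ℝ (Fin n))) :
    Function.Injective (testToL2 Ω) := by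
  intro φ ψ h
  have h' := (MemLp.toLp_eq_toLp_iff (testFunction_memLp φ) (testFunction_memLp ψ)).1 h
  have hon := Measure.eqOn_open_of_ae_eq h' Ω.isOpen φ.continuous.continuousOn
    ψ.continuous.continuousOn
  ext x
  by_cases hx : x ∈ (Ω : Set (EuclideanSpace ℝ (Fin n)))
  · exact hon hx
  · rw [image_eq_zero_of_notMem_tsupport fun hc => hx (φ.tsupport_subset hc),
      image_eq_zero_of_notMem_tsupport fun hc => hx (ψ.tsupport_subset hc)]

/-- The map `φ ↦ -Δφ + Vφ` from `C₀^∞(Ω)` to `L²(Ω)`. -/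
noncomputable def schrodingerMap {V : EuclideanSpace ℝ (Fin n) → ℝ} (hV : LocallyLInfty Ω V) :
    𝓓(Ω, ℂ) →ₗ[ℂ] L2 Ω where
  toFun φ := (schrodingerFun_memLp hV φ).toLp (schrodingerFun V φ)
  map_add' φ ψ := by
    rw [← MemLp.toLp_add]
    congr 1
    funext x
    have h := (testFunction_contDiffAt φ x).laplacian_add (testFunction_contDiffAt ψ x)
    change -(Laplacian.laplacian ((φ : EuclideanSpace ℝ (Fin n) → ℂ) + ψ) x)
      + (V x : ℂ) * (φ x + ψ x) = schrodingerFun V φ x + schrodingerFun V ψ x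
    rw [h, schrodingerFun, schrodingerFun]
    ring
  map_smul' c φ := by
    rw [RingHom.id_apply, ← MemLp.toLp_const_smul]
    congr 1
    funext x
    have h := InnerProductSpace.laplacian_smul c (testFunction_contDiffAt φ x)
    change -(Laplacian.laplacian (c • (φ : EuclideanSpace ℝ (Fin n) → ℂ)) x)
      + (V x : ℂ) * (c • φ x) = c • schrodingerFun V φ x
    rw [h, schrodingerFun, smul_eq_mul, smul_eq_mul, smul_eq_mul]
    ring

end

/-- The Schrödinger operator `H = -Δ + V` in `L²(Ω)` with domain `C₀^∞(Ω)`. -/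
noncomputable def schrodingerOp {n : ℕ} (Ω : Opens (EuclideanSpace ℝ (Fin n)))
    (V : EuclideanSpace ℝ (Fin n) → ℝ) (hV : LocallyLInfty Ω V) : L2 Ω →ₗ.[ℂ] L2 Ω where
  domain := LinearMap.range (testToL2 Ω)
  toFun := schrodingerMap hV ∘ₗ
    (LinearEquiv.ofInjective (testToL2 Ω) (testToL2_injective Ω)).symm.toLinearMap

theorem schrodingerOp_apply {n : ℕ} (Ω : Opens (EuclideanSpace ℝ (Fin n)))
    (V : EuclideanSpace ℝ (Fin n) → ℝ) (hV : LocallyLInfty Ω V) (φ : 𝓓(Ω, ℂ)) :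
    schrodingerOp Ω V hV ⟨testToL2 Ω φ, LinearMap.mem_range_self _ φ⟩ = schrodingerMap hV φ :=
  congrArg (schrodingerMap hV) ((LinearEquiv.symm_apply_eq _).2 (Subtype.ext rfl))

/-- A densely defined symmetric operator is essentially self-adjoint if its closure is
self-adjoint. -/
def IsEssentiallySelfAdjoint {F : Type*} [NormedAddCommGroup F] [InnerProductSpace ℂ F]
    [CompleteSpace F] (A : F →ₗ.[ℂ] F) : Prop :=
  Dense (A.domain : Set F) ∧ A.IsFormalAdjoint A ∧ A.IsClosable ∧ IsSelfAdjoint A.closure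

/-! Let `δ` be the distance to the complement of `Ω`. A `C²` boundary gives exterior balls of a
uniform radius `ρ`, so `δ` lies below `|· - z| - ρ` with equality at a given point, and `Δδ ≤ n / ρ`
holds weakly. Calibrating with the solution `h` of a Riccati inequality, this yields the Hardy
inequality with the optimal constant, `∫ (1 / (4δ²) - ¾ (n / ρ)²) g² ≤ ∫ ‖∇g‖²`, hence
`H - e ≥ 1` for a sufficiently negative `e`.

A symmetric operator with `H - e ≥ 1` is essentially self-adjoint once the range of `H - e` is
dense. A function `ψ ∈ L²(Ω)` orthogonal to the range is a weak solution of `Δψ = (V - e) ψ`. The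
Hardy inequality for `f ψ`, with the Agmon weight `f = exp (G δ)` cut off on the shell
`s / 2 ≤ δ < s`, bounds the mass of `ψ` in `δ ≥ ρ₀` by a multiple of `s⁻² exp (2 G s)` times its
mass in the shell. With `s = 2⁻ᵏ ρ₀`, the masses in the disjoint shells are at least a constant
times the terms of the divergent series in condition (Σ), unless `ψ` vanishes on `δ ≥ ρ₀`. -/

section EssentialSelfAdjointness

variable {𝕜 F : Type*} [RCLike 𝕜] [NormedAddCommGroup F] [InnerProductSpace 𝕜 F]

theorem inner_snd_fst_eq_of_mem_topologicalClosure_graph {A : F →ₗ.[𝕜] F}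
    (hA : A.IsFormalAdjoint A) {p q : F × F} (hp : p ∈ A.graph.topologicalClosure)
    (hq : q ∈ A.graph.topologicalClosure) : inner 𝕜 p.2 q.1 = inner 𝕜 p.1 q.2 := by
  have hgraph : ∀ p ∈ A.graph, ∀ q ∈ A.graph, inner 𝕜 p.2 q.1 = inner 𝕜 p.1 q.2 := by
    intro p hp q hq
    obtain ⟨x, hx, hAx⟩ := (LinearPMap.mem_graph_iff A).1 hp
    obtain ⟨y, hy, hAy⟩ := (LinearPMap.mem_graph_iff A).1 hq
    rw [← hx, ← hAx, ← hy, ← hAy]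
    exact hA x y
  have hclosed_right (p : F × F) :
      _root_.IsClosed {q : F × F | inner 𝕜 p.2 q.1 = inner 𝕜 p.1 q.2} :=
    isClosed_eq (by fun_prop) (by fun_prop)
  have hclosed_left (q : F × F) :
      _root_.IsClosed {p : F × F | inner 𝕜 p.2 q.1 = inner 𝕜 p.1 q.2} :=
    isClosed_eq (by fun_prop) (by fun_prop)
  exact closure_minimal
    (fun p hp => closure_minimal (fun q hq => hgraph p hp q hq) (hclosed_right p) hq)
    (hclosed_left q) hp

theorem norm_le_norm_of_sq_le_re_inner {x y : F} (h : ‖x‖ ^ 2 ≤ RCLike.re (inner 𝕜 x y)) :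
    ‖x‖ ≤ ‖y‖ := by
  have hcs : ‖x‖ * ‖x‖ ≤ ‖x‖ * ‖y‖ :=
    (sq ‖x‖).symm.trans_le (h.trans ((RCLike.re_le_norm _).trans (norm_inner_le_norm x y)))
  rcases (norm_nonneg x).eq_or_lt with hx | hx
  · exact hx ▸ norm_nonneg y
  · exact le_of_mul_le_mul_left hcs hx

theorem denseRange_of_forall_inner_eq_zero [CompleteSpace F] {D : Type*} [AddCommGroup D]
    [Module 𝕜 D] (R : D →ₗ[𝕜] F) (h : ∀ ψ : F, (∀ x, inner 𝕜 ψ (R x) = 0) → ψ = 0) :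
    DenseRange R := by
  have hbot : (LinearMap.range R)ᗮ = ⊥ := by
    rw [Submodule.eq_bot_iff]
    exact fun ψ hψ => h ψ fun x => (Submodule.mem_orthogonal' _ _).1 hψ (R x) ⟨x, rfl⟩
  have hdense := Submodule.dense_iff_topologicalClosure_eq_top.2
    ((Submodule.topologicalClosure_eq_top_iff (K := LinearMap.range R)).2 hbot)
  rwa [LinearMap.coe_range] at hdense

theorem exists_mem_topologicalClosure_graph_of_denseRange [CompleteSpace F] {A : F →ₗ.[𝕜] F}
    {c : 𝕜} (hlow : ∀ x : A.domain, ‖(x : F)‖ ≤ ‖A x - c • (x : F)‖)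
    (hdense : DenseRange fun x : A.domain => A x - c • (x : F)) (f : F) :
    ∃ y, (y, f + c • y) ∈ A.graph.topologicalClosure := by
  obtain ⟨w, hw, hlim⟩ := mem_closure_iff_seq_limit.1 (hdense f)
  choose a ha using hw
  replace ha (k : ℕ) : A (a k) - c • (a k : F) = w k := ha k
  have hdist (j k : ℕ) : dist (a j : F) (a k) ≤ dist (w j) (w k) := by
    have h := hlow (a j - a k)
    rwa [LinearPMap.map_sub, Submodule.coe_sub, smul_sub, sub_sub_sub_comm, ha, ha,
      ← dist_eq_norm, ← dist_eq_norm] at h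
  have hcauchy : CauchySeq fun k => (a k : F) := by
    rw [Metric.cauchySeq_iff']
    intro ε hε
    obtain ⟨N, hN⟩ := Metric.cauchySeq_iff'.1 hlim.cauchySeq ε hε
    exact ⟨N, fun k hk => (hdist k N).trans_lt (hN k hk)⟩
  obtain ⟨y, hy⟩ := cauchySeq_tendsto_of_complete hcauchy
  have hAy : Tendsto (fun k => A (a k)) atTop (𝓝 (f + c • y)) :=
    (hlim.add (hy.const_smul c)).congr fun k => by rw [← ha, sub_add_cancel]
  exact ⟨y, mem_closure_of_tendsto (hy.prodMk_nhds hAy)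
    (Eventually.of_forall fun k => A.mem_graph (a k))⟩

theorem isEssentiallySelfAdjoint_of_coercive {F : Type*} [NormedAddCommGroup F]
    [InnerProductSpace ℂ F] [CompleteSpace F] {A : F →ₗ.[ℂ] F} (hd : Dense (A.domain : Set F))
    (hs : A.IsFormalAdjoint A) {e : ℝ}
    (hco : ∀ x : A.domain, ‖(x : F)‖ ^ 2 ≤ (inner ℂ (x : F) (A x - (e : ℂ) • (x : F))).re)
    (hker : ∀ ψ : F, (∀ x : A.domain, inner ℂ ψ (A x - (e : ℂ) • (x : F)) = 0) → ψ = 0) :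
    IsEssentiallySelfAdjoint A := by
  have hcl : A.IsClosable :=
    (LinearPMap.adjoint_isClosed hd).isClosable.leIsClosable (hs.le_adjoint hd)
  refine ⟨hd, hs, hcl, ?_⟩
  rw [LinearPMap.isSelfAdjoint_def]
  apply LinearPMap.eq_of_eq_graph
  rw [LinearPMap.adjoint_graph_eq_graph_adjoint (hd.mono A.le_closure.1),
    ← hcl.graph_closure_eq_closure_graph]
  ext ⟨x, x'⟩
  rw [Submodule.mem_adjoint_iff]
  refine ⟨fun hx => ?_, fun hx a b hab =>
    sub_eq_zero.2 (inner_snd_fst_eq_of_mem_topologicalClosure_graph hs hab hx)⟩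
  obtain ⟨y, hy⟩ := exists_mem_topologicalClosure_graph_of_denseRange
    (fun x => norm_le_norm_of_sq_le_re_inner (𝕜 := ℂ) (hco x))
    (denseRange_of_forall_inner_eq_zero (A.toFun - (e : ℂ) • A.domain.subtype) hker)
    (x' - (e : ℂ) • x)
  -- `y` solves `(closure A - e) y = (A† - e) x`, so `x - y` is orthogonal to the range of `A - e`.
  obtain rfl : x = y := by
    refine sub_eq_zero.1 (hker _ fun z => ?_)
    have hz : ((z : F), A z) ∈ A.graph.topologicalClosure := subset_closure (A.mem_graph z)
    have hxz := hx _ _ hz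
    have hyz := inner_snd_fst_eq_of_mem_topologicalClosure_graph hs hz hy
    rw [inner_eq_zero_symm]
    simp only [inner_sub_left, inner_sub_right, inner_add_right, inner_smul_left, inner_smul_right,
      Complex.conj_ofReal] at hxz hyz ⊢
    linear_combination hxz - hyz
  simpa only [sub_add_cancel] using hy

end EssentialSelfAdjointness

section ExteriorBalls

/-- The exterior ball condition at a boundary point: `y` lies on a sphere of radius `ρ` whose open
ball misses `Ω`. -/
def HasExteriorBallAt {E : Type*} [PseudoMetricSpace E] (Ω : Set E) (ρ : ℝ) (y : E) : Prop :=
  ∃ z, dist y z = ρ ∧ Disjoint (Metric.ball z ρ) Ω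

/-- The uniform exterior ball condition with radius `ρ`: the one-sided form of `C²` regularity which
bounds `Δδ` from above, `δ` being the distance to the complement. -/
structure HasExteriorBalls {E : Type*} [PseudoMetricSpace E] (Ω : Set E) (ρ : ℝ) : Prop where
  radius_pos : 0 < ρ
  exteriorBallAt : ∀ y ∈ frontier Ω, HasExteriorBallAt Ω ρ y

theorem HasExteriorBallAt.mono {E : Type*} [NormedAddCommGroup E] [NormedSpace ℝ E] {Ω : Set E}
    {ρ ρ' : ℝ} {y : E} (h : HasExteriorBallAt Ω ρ y) (hρ' : 0 < ρ') (hle : ρ' ≤ ρ) :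
    HasExteriorBallAt Ω ρ' y := by
  obtain ⟨z, hyz, hdisj⟩ := h
  have hρ : 0 < ρ := hρ'.trans_le hle
  have hzz' : dist (AffineMap.lineMap y z (ρ' / ρ)) z = ρ - ρ' := by
    rw [dist_lineMap_right, hyz, Real.norm_of_nonneg (sub_nonneg.2 ((div_le_one hρ).2 hle))]
    field_simp
  refine ⟨AffineMap.lineMap y z (ρ' / ρ), ?_, hdisj.mono_left (Metric.ball_subset_ball' ?_)⟩
  · rw [dist_left_lineMap, hyz, Real.norm_of_nonneg (by positivity), div_mul_cancel₀ _ hρ.ne']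
  · rw [hzz', add_sub_cancel]

theorem eq_zero_of_mem_frontier_of_inter_eq_sublevel {X : Type*} [TopologicalSpace X]
    {Ω U : Set X} {r : X → ℝ} (hΩ : IsOpen Ω) (hU : IsOpen U) (hr : ContinuousOn r U)
    (hΩU : Ω ∩ U = {x | x ∈ U ∧ r x < 0}) {y : X} (hy : y ∈ frontier Ω) (hyU : y ∈ U) :
    r y = 0 := by
  apply le_antisymm
  · have hcl : y ∈ closure (Ω ∩ U) := by
      rw [inter_comm]
      exact hU.inter_closure ⟨hyU, frontier_subset_closure hy⟩
    have himage : r '' (Ω ∩ U) ⊆ Iic 0 := by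
      rintro _ ⟨w, hw, rfl⟩
      exact (hΩU.subset hw).2.le
    exact closure_minimal himage isClosed_Iic
      ((hr.continuousAt (hU.mem_nhds hyU)).continuousWithinAt.mem_closure_image hcl)
  · by_contra! hneg
    exact (disjoint_frontier_iff_isOpen.2 hΩ).notMem_of_mem_left hy (hΩU.superset ⟨hyU, hneg⟩).1

theorem norm_sub_sub_fderiv_le_of_lipschitzOnWith {E F : Type*} [NormedAddCommGroup E]
    [NormedSpace ℝ E] [NormedAddCommGroup F] [NormedSpace ℝ F] {f : E → F} {s : Set E} {C : NNReal}
    (hs : Convex ℝ s) (hf : ∀ x ∈ s, DifferentiableAt ℝ f x)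
    (hlip : LipschitzOnWith C (fderiv ℝ f) s) {x y : E} (hx : x ∈ s) (hy : y ∈ s) :
    ‖f x - f y - fderiv ℝ f y (x - y)‖ ≤ C * ‖x - y‖ ^ 2 := by
  have hseg : segment ℝ y x ⊆ s := hs.segment_subset hy hx
  rw [sq, ← mul_assoc]
  refine (convex_segment y x).norm_image_sub_le_of_norm_fderiv_le' (fun w hw => hf w (hseg hw))
    (fun w hw => (hlip.norm_sub_le (hseg hw) hy).trans ?_)
    (left_mem_segment ℝ y x) (right_mem_segment ℝ y x)
  gcongr
  exact norm_sub_le_of_mem_segment hw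

variable {E : Type*} [NormedAddCommGroup E] [InnerProductSpace ℝ E]

theorem sq_norm_sub_lt_of_mem_ball_add_smul {x y ν : E} {ρ : ℝ} (hν : ‖ν‖ = 1) (hρ : 0 ≤ ρ)
    (hx : x ∈ Metric.ball (y + ρ • ν) ρ) : ‖x - y‖ ^ 2 < 2 * ρ * inner ℝ (x - y) ν := by
  rw [Metric.mem_ball, dist_eq_norm, ← sub_sub] at hx
  have hsq : ‖x - y - ρ • ν‖ ^ 2 < ρ ^ 2 := by gcongr
  have hexpand := norm_sub_sq_real (x - y) (ρ • ν)
  rw [norm_smul, hν, inner_smul_right, Real.norm_of_nonneg hρ] at hexpand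
  linarith

/-- The Taylor remainder `C|x - y|²` is less than `2Cρ⟨x - y, ν⟩` in the ball of radius `ρ` touching
`y` in the direction `ν` of the gradient, so the linear term `|∇r(y)|⟨x - y, ν⟩` wins there. -/
theorem hasExteriorBallAt_of_lipschitzOnWith_fderiv [CompleteSpace E] {Ω : Set E} {r : E → ℝ}
    {y : E} {ρ : ℝ} {C : NNReal} (hρ : 0 < ρ)
    (hr : ∀ x ∈ Metric.ball y (2 * ρ), DifferentiableAt ℝ r x)
    (hlip : LipschitzOnWith C (fderiv ℝ r) (Metric.ball y (2 * ρ)))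
    (hΩ : ∀ x ∈ Ω ∩ Metric.ball y (2 * ρ), r x < 0) (hy : r y = 0)
    (hy' : fderiv ℝ r y ≠ 0) (hC : 2 * C * ρ ≤ ‖fderiv ℝ r y‖) :
    HasExteriorBallAt Ω ρ y := by
  set g := gradient r y
  have hg : ‖g‖ = ‖fderiv ℝ r y‖ := LinearIsometryEquiv.norm_map _ _
  have hg0 : 0 < ‖g‖ := hg ▸ norm_pos_iff.2 hy'
  set ν := ‖g‖⁻¹ • g with hν
  have hν1 : ‖ν‖ = 1 := norm_smul_inv_norm (𝕜 := ℝ) (norm_pos_iff.1 hg0)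
  have hcenter : dist y (y + ρ • ν) = ρ := by
    rw [dist_self_add_right, norm_smul, hν1, Real.norm_of_nonneg hρ.le, mul_one]
  refine ⟨y + ρ • ν, hcenter, Set.disjoint_left.2 fun x hx hxΩ => ?_⟩
  have hxball : x ∈ Metric.ball y (2 * ρ) := by
    rw [Metric.mem_ball] at hx ⊢
    linarith [dist_triangle x (y + ρ • ν) y, dist_comm y (y + ρ • ν)]
  have htaylor := norm_sub_sub_fderiv_le_of_lipschitzOnWith (convex_ball y (2 * ρ)) hr hlip hxball
    (Metric.mem_ball_self (by positivity))
  have hlinear : fderiv ℝ r y (x - y) = ‖g‖ * inner ℝ (x - y) ν := by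
    rw [hν, inner_smul_right, real_inner_comm, inner_gradient_left,
      mul_inv_cancel_left₀ hg0.ne']
  have htouch := sq_norm_sub_lt_of_mem_ball_add_smul hν1 hρ.le hx
  have hinner : 0 < inner ℝ (x - y) ν :=
    pos_of_mul_pos_right ((sq_nonneg _).trans_lt htouch) (by positivity)
  have hremainder : C * ‖x - y‖ ^ 2 ≤ ‖g‖ * inner ℝ (x - y) ν := calc
    C * ‖x - y‖ ^ 2 ≤ C * (2 * ρ * inner ℝ (x - y) ν) := by gcongr
    _ = 2 * C * ρ * inner ℝ (x - y) ν := by ring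
    _ ≤ ‖g‖ * inner ℝ (x - y) ν := by gcongr; exact hC.trans_eq hg.symm
  rw [hy, sub_zero, Real.norm_eq_abs, hlinear] at htaylor
  linarith [(abs_le.1 htaylor).1, hΩ x ⟨hxΩ, hxball⟩]

theorem exists_eventually_hasExteriorBallAt_of_contDiffOn [CompleteSpace E] {Ω U : Set E}
    {r : E → ℝ} {x₀ : E} (hΩ : IsOpen Ω) (hU : IsOpen U) (hx₀ : x₀ ∈ U) (hr : ContDiffOn ℝ 2 r U)
    (hr' : fderiv ℝ r x₀ ≠ 0) (hΩU : Ω ∩ U = {x | x ∈ U ∧ r x < 0}) :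
    ∃ ρ > 0, ∀ᶠ y in 𝓝 x₀, y ∈ frontier Ω → HasExteriorBallAt Ω ρ y := by
  have hd1 : ContDiffAt ℝ 1 (fderiv ℝ r) x₀ :=
    (hr.contDiffAt (hU.mem_nhds hx₀)).fderiv_right (m := 1) (by norm_num)
  obtain ⟨C, T, hT, hlip⟩ := hd1.exists_lipschitzOnWith
  obtain ⟨m, hm0, hm⟩ := exists_between (norm_pos_iff.2 hr')
  obtain ⟨ε, hε, hball⟩ := Metric.mem_nhds_iff.1 (inter_mem hT (hU.mem_nhds hx₀))
  set ρ := min (ε / 4) (m / (2 * (C + 1)))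
  have hρ : 0 < ρ := by positivity
  have hρC : 2 * C * ρ ≤ m := calc
    2 * C * ρ ≤ 2 * (C + 1) * (m / (2 * (C + 1))) := by
      gcongr
      exacts [by linarith, min_le_right _ _]
    _ = m := by field_simp
  refine ⟨ρ, hρ, ?_⟩
  filter_upwards [Metric.ball_mem_nhds x₀ (half_pos hε),
    hd1.continuousAt.norm.eventually (lt_mem_nhds hm)] with y hyball hmy hyΩ
  have hsub : Metric.ball y (2 * ρ) ⊆ T ∩ U :=
    (Metric.ball_subset_ball' (by
      linarith [min_le_left (ε / 4) (m / (2 * (C + 1))), Metric.mem_ball.1 hyball])).trans hball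
  refine hasExteriorBallAt_of_lipschitzOnWith_fderiv hρ
    (fun x hx => (hr.contDiffAt (hU.mem_nhds (hsub hx).2)).differentiableAt two_ne_zero)
    (hlip.mono fun x hx => (hsub hx).1)
    (fun x hx => (hΩU.subset ⟨hx.1, (hsub hx.2).2⟩).2)
    (eq_zero_of_mem_frontier_of_inter_eq_sublevel hΩ hU hr.continuousOn hΩU hyΩ
      (hsub (Metric.mem_ball_self (by positivity))).2)
    (norm_pos_iff.1 (hm0.trans hmy)) (hρC.trans hmy.le)

theorem HasC2Boundary.exists_hasExteriorBalls {n : ℕ} {Ω : Opens (EuclideanSpace ℝ (Fin n))}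
    (h : HasC2Boundary Ω) (hbdd : Bornology.IsBounded (Ω : Set (EuclideanSpace ℝ (Fin n)))) :
    ∃ ρ, HasExteriorBalls (Ω : Set (EuclideanSpace ℝ (Fin n))) ρ := by
  have hcompact : IsCompact (frontier (Ω : Set (EuclideanSpace ℝ (Fin n)))) :=
    Metric.isCompact_of_isClosed_isBounded isClosed_frontier
      (hbdd.closure.subset frontier_subset_closure)
  suffices ∃ ρ > 0, ∀ y ∈ frontier (Ω : Set (EuclideanSpace ℝ (Fin n))),
      y ∈ frontier (Ω : Set (EuclideanSpace ℝ (Fin n))) →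
        HasExteriorBallAt (Ω : Set (EuclideanSpace ℝ (Fin n))) ρ y by
    obtain ⟨ρ, hρ, hball⟩ := this
    exact ⟨ρ, hρ, fun y hy => hball y hy hy⟩
  refine hcompact.induction_on
    (p := fun S => ∃ ρ > 0, ∀ y ∈ S, y ∈ frontier (Ω : Set (EuclideanSpace ℝ (Fin n))) →
      HasExteriorBallAt (Ω : Set (EuclideanSpace ℝ (Fin n))) ρ y)
    ⟨1, one_pos, by simp⟩ ?_ ?_ ?_
  · rintro S T hST ⟨ρ, hρ, hball⟩
    exact ⟨ρ, hρ, fun y hy => hball y (hST hy)⟩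
  · rintro S T ⟨ρ₁, hρ₁, h₁⟩ ⟨ρ₂, hρ₂, h₂⟩
    refine ⟨min ρ₁ ρ₂, lt_min hρ₁ hρ₂, ?_⟩
    rintro y (hy | hy) hyΩ
    · exact (h₁ y hy hyΩ).mono (lt_min hρ₁ hρ₂) (min_le_left _ _)
    · exact (h₂ y hy hyΩ).mono (lt_min hρ₁ hρ₂) (min_le_right _ _)
  · intro x hx
    obtain ⟨U, r, hU, hxU, hr, hr', hΩU⟩ := h x hx
    obtain ⟨ρ, hρ, hball⟩ := exists_eventually_hasExteriorBallAt_of_contDiffOn Ω.isOpen hU hxU hr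
      (hr' x hxU) hΩU
    exact ⟨_, mem_nhdsWithin_of_mem_nhds hball, ρ, hρ, fun y hy => hy⟩

end ExteriorBalls

section DistanceFunction

theorem infDist_frontier_eq_infDist_compl {E : Type*} [NormedAddCommGroup E] [NormedSpace ℝ E]
    [FiniteDimensional ℝ E] {Ω : Set E} (hΩ : IsOpen Ω) (hne : Ω ≠ univ) {x : E} (hx : x ∈ Ω) :
    Metric.infDist x (frontier Ω) = Metric.infDist x Ωᶜ := by
  obtain ⟨y, hy, hxy⟩ := exists_mem_frontier_infDist_compl_eq_dist hx hne
  apply le_antisymm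
  · rw [hxy]
    exact Metric.infDist_le_dist_of_mem hy
  · exact Metric.infDist_le_infDist_of_subset
      (disjoint_frontier_iff_isOpen.2 hΩ).subset_compl_right ⟨y, hy⟩

theorem bdryDist_eq_infDist_compl {n : ℕ} {Ω : Opens (EuclideanSpace ℝ (Fin n))}
    (hne : (Ω : Set (EuclideanSpace ℝ (Fin n))) ≠ univ) {x : EuclideanSpace ℝ (Fin n)}
    (hx : x ∈ Ω) :
    bdryDist Ω x = Metric.infDist x (Ω : Set (EuclideanSpace ℝ (Fin n)))ᶜ :=
  infDist_frontier_eq_infDist_compl Ω.isOpen hne hx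

theorem infDist_compl_pos {E : Type*} [PseudoMetricSpace E] {Ω : Set E} (hΩ : IsOpen Ω)
    (hne : Ω ≠ univ) {x : E} (hx : x ∈ Ω) : 0 < Metric.infDist x Ωᶜ :=
  (hΩ.isClosed_compl.notMem_iff_infDist_pos (nonempty_compl.2 hne)).1 (not_not_intro hx)

theorem exists_pos_lt_infDist_compl {E : Type*} [PseudoMetricSpace E] {Ω S : Set E}
    (hΩ : IsOpen Ω) (hne : Ω ≠ univ) (hS : IsCompact S) (hSΩ : S ⊆ Ω) :
    ∃ s > 0, ∀ x ∈ S, s < Metric.infDist x Ωᶜ := by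
  obtain ⟨s, hs, hlt⟩ := hS.exists_forall_le' (f := fun x => Metric.infDist x Ωᶜ)
    (Metric.continuous_infDist_pt _).continuousOn (fun x hx => infDist_compl_pos hΩ hne (hSΩ hx))
  exact ⟨s / 2, half_pos hs, fun x hx => (half_lt_self hs).trans_le (hlt x hx)⟩

theorem isCompact_setOf_le_infDist_compl {E : Type*} [PseudoMetricSpace E] [ProperSpace E]
    {Ω : Set E} (hb : Bornology.IsBounded Ω) {s : ℝ} (hs : 0 < s) :
    IsCompact {x | s ≤ Metric.infDist x Ωᶜ} := by
  refine Metric.isCompact_of_isClosed_isBounded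
    (isClosed_le continuous_const (Metric.continuous_infDist_pt _)) (hb.subset fun x hx => ?_)
  by_contra hxΩ
  have hx0 : Metric.infDist x Ωᶜ = 0 := Metric.infDist_zero_of_mem hxΩ
  exact hs.not_ge (hx0 ▸ hx)

theorem infDist_lineMap_eq {E : Type*} [NormedAddCommGroup E] [NormedSpace ℝ E] {s : Set E}
    {x y : E} (hy : y ∈ s) (hxy : Metric.infDist x s = dist x y) {t : ℝ} (ht : t ∈ Icc 0 1) :
    Metric.infDist (AffineMap.lineMap x y t) s = (1 - t) * dist x y := by
  apply le_antisymm
  · refine (Metric.infDist_le_dist_of_mem hy).trans_eq ?_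
    rw [dist_lineMap_right, Real.norm_of_nonneg (sub_nonneg.2 ht.2)]
  · have h : Metric.infDist x s ≤ Metric.infDist (AffineMap.lineMap x y t) s
        + dist x (AffineMap.lineMap x y t) := Metric.infDist_le_infDist_add_dist
    rw [dist_left_lineMap, Real.norm_of_nonneg ht.1, hxy] at h
    linarith

theorem norm_fderiv_infDist_eq_one {E : Type*} [NormedAddCommGroup E] [NormedSpace ℝ E]
    [ProperSpace E] {s : Set E} (hs : IsClosed s) (hne : s.Nonempty) {x : E} (hx : x ∉ s)
    (hd : DifferentiableAt ℝ (fun y => Metric.infDist y s) x) :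
    ‖fderiv ℝ (fun y => Metric.infDist y s) x‖ = 1 := by
  apply le_antisymm
  · simpa using norm_fderiv_le_of_lipschitz ℝ (x₀ := x) (Metric.lipschitz_infDist_pt s)
  obtain ⟨y, hy, hxy⟩ := hs.exists_infDist_eq_dist hne x
  have hpos : 0 < ‖y - x‖ := norm_pos_iff.2 (sub_ne_zero.2 fun h => hx (h ▸ hy))
  have hderiv : HasDerivWithinAt (fun t : ℝ => Metric.infDist (AffineMap.lineMap x y t) s)
      (fderiv ℝ (fun y => Metric.infDist y s) x (y - x)) (Ici 0) 0 := by
    have hd' : HasFDerivAt (fun y => Metric.infDist y s)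
        (fderiv ℝ (fun y => Metric.infDist y s) x) (AffineMap.lineMap x y (0 : ℝ)) := by
      rw [AffineMap.lineMap_apply_zero]
      exact hd.hasFDerivAt
    exact (hd'.comp_hasDerivAt (0 : ℝ) AffineMap.hasDerivAt_lineMap).hasDerivWithinAt
  have hlinear : HasDerivWithinAt (fun t : ℝ => Metric.infDist (AffineMap.lineMap x y t) s)
      (-‖y - x‖) (Ici 0) 0 := by
    have h : HasDerivWithinAt (fun t : ℝ => (1 - t) * dist x y) (-‖y - x‖) (Ici 0) 0 := by
      simpa [dist_eq_norm, norm_sub_rev x y] using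
        (((hasDerivAt_id (0 : ℝ)).const_sub 1).mul_const (dist x y)).hasDerivWithinAt
    refine h.congr_of_eventuallyEq ?_ (infDist_lineMap_eq hy hxy (left_mem_Icc.2 zero_le_one))
    filter_upwards [Icc_mem_nhdsGE (zero_lt_one' ℝ)] with t ht using infDist_lineMap_eq hy hxy ht
  have hle := (fderiv ℝ (fun y => Metric.infDist y s) x).le_opNorm (y - x)
  rw [(uniqueDiffWithinAt_Ici (0 : ℝ)).eq_deriv _ hderiv hlinear, norm_neg, norm_norm] at hle
  exact le_of_mul_le_mul_right (by rwa [one_mul]) hpos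

theorem infDist_closedBall_le_dist_sub {E : Type*} [NormedAddCommGroup E] [NormedSpace ℝ E]
    {p z : E} {ρ : ℝ} (hρ : 0 ≤ ρ) (hp : ρ ≤ dist p z) :
    Metric.infDist p (Metric.closedBall z ρ) ≤ dist p z - ρ := by
  rcases hρ.eq_or_lt with rfl | hρ
  · simp [Metric.closedBall_zero]
  have hpz : 0 < dist p z := hρ.trans_le hp
  have hmem : AffineMap.lineMap z p (ρ / dist p z) ∈ Metric.closedBall z ρ := by
    rw [Metric.mem_closedBall, dist_lineMap_left, dist_comm z p,
      Real.norm_of_nonneg (by positivity), div_mul_cancel₀ _ hpz.ne']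
  refine (Metric.infDist_le_dist_of_mem hmem).trans_eq ?_
  rw [dist_right_lineMap, dist_comm z p,
    Real.norm_of_nonneg (sub_nonneg.2 ((div_le_one hpz).2 hp))]
  field_simp

variable {E : Type*} [NormedAddCommGroup E] [InnerProductSpace ℝ E]

theorem norm_add_add_norm_sub_le {q : E} (hq : q ≠ 0) (w : E) :
    ‖q + w‖ + ‖q - w‖ ≤ 2 * ‖q‖ + ‖w‖ ^ 2 / ‖q‖ := by
  have : 0 < ‖q‖ := norm_pos_iff.2 hq
  have hexpand : (2 * ‖q‖ + ‖w‖ ^ 2 / ‖q‖) ^ 2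
      = 4 * ‖q‖ ^ 2 + 4 * ‖w‖ ^ 2 + (‖w‖ ^ 2 / ‖q‖) ^ 2 := by
    field_simp
    ring
  have hparallelogram := parallelogram_law_with_norm ℝ q w
  refine le_of_sq_le_sq ?_ (by positivity)
  nlinarith [sq_nonneg (‖q + w‖ - ‖q - w‖), sq_nonneg (‖w‖ ^ 2 / ‖q‖)]

/-- With `y` a boundary point nearest to `x` and `z` the centre of an exterior ball at `y`, the
function `|· - z| - ρ` touches the distance function from above at `x`. -/
theorem infDist_compl_add_sub_le [FiniteDimensional ℝ E] {Ω : Set E} {ρ : ℝ} (hΩ : IsOpen Ω)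
    (hne : Ω ≠ univ) (hball : HasExteriorBalls Ω ρ) {x w : E} (hx : x ∈ Ω) (hp : x + w ∈ Ω)
    (hm : x - w ∈ Ω) :
    Metric.infDist (x + w) Ωᶜ + Metric.infDist (x - w) Ωᶜ - 2 * Metric.infDist x Ωᶜ
      ≤ ‖w‖ ^ 2 / ρ := by
  have hρ := hball.radius_pos
  obtain ⟨y, hy, hxy⟩ := exists_mem_frontier_infDist_compl_eq_dist hx hne
  obtain ⟨z, hyz, hdisj⟩ := hball.exteriorBallAt y hy
  have hclosedBall : Disjoint (Metric.closedBall z ρ) Ω := by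
    rw [← closure_ball z hρ.ne']
    exact hdisj.closure_left hΩ
  have hfar {p : E} (hp : p ∈ Ω) : ρ < dist p z := by
    by_contra! hle
    exact hclosedBall.notMem_of_mem_left hle hp
  have habove {p : E} (hp : p ∈ Ω) : Metric.infDist p Ωᶜ ≤ ‖p - z‖ - ρ := by
    rw [← dist_eq_norm]
    exact (Metric.infDist_le_infDist_of_subset hclosedBall.subset_compl_right
      (Metric.nonempty_closedBall.2 hρ.le)).trans
      (infDist_closedBall_le_dist_sub hρ.le (hfar hp).le)
  have htouch : ‖x - z‖ - ρ ≤ Metric.infDist x Ωᶜ := by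
    rw [hxy, ← hyz, ← dist_eq_norm]
    linarith [dist_triangle x y z]
  have hxz : ρ < ‖x - z‖ := dist_eq_norm x z ▸ hfar hx
  have hsecond := norm_add_add_norm_sub_le (norm_pos_iff.1 (hρ.trans hxz)) w
  have hcurv : ‖w‖ ^ 2 / ‖x - z‖ ≤ ‖w‖ ^ 2 / ρ := by gcongr
  have hplus := habove hp
  have hminus := habove hm
  rw [add_sub_right_comm] at hplus
  rw [sub_right_comm] at hminus
  linarith

end DistanceFunction

section LipschitzCalculus

/-- Lipschitz functions with compact support: the class of test functions for the energy
estimates, differentiable almost everywhere by Rademacher's theorem. -/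
structure IsCompactLipschitz {E : Type*} [PseudoMetricSpace E] (f : E → ℝ) : Prop where
  exists_lipschitzWith : ∃ C, LipschitzWith C f
  hasCompactSupport : HasCompactSupport f

namespace IsCompactLipschitz

theorem of_contDiff {E : Type*} [NormedAddCommGroup E] [NormedSpace ℝ E] {f : E → ℝ}
    (hf : ContDiff ℝ 1 f) (hc : HasCompactSupport f) : IsCompactLipschitz f :=
  ⟨hf.lipschitzWith_of_hasCompactSupport hc one_ne_zero, hc⟩

variable {E : Type*} [PseudoMetricSpace E] {f g : E → ℝ}

protected theorem continuous (hf : IsCompactLipschitz f) : Continuous f :=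
  hf.exists_lipschitzWith.choose_spec.continuous

theorem mul_of_lipschitzOnWith {D : NNReal} (hf : IsCompactLipschitz f)
    (hg : LipschitzOnWith D g (tsupport f)) : IsCompactLipschitz fun x => f x * g x := by
  obtain ⟨C, hC⟩ := hf.exists_lipschitzWith
  obtain ⟨A, hA⟩ := hf.hasCompactSupport.isCompact.exists_bound_of_continuousOn
    hf.continuous.continuousOn
  obtain ⟨B, hB⟩ := hf.hasCompactSupport.isCompact.exists_bound_of_continuousOn hg.continuousOn
  have hleft {x y : E} (hx : x ∈ tsupport f) :
      ‖f x * g x - f y * g y‖ ≤ (|A| * D + |B| * C) * dist x y := by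
    have : ‖f x‖ ≤ |A| := (hA x hx).trans (le_abs_self A)
    have hgx : ‖g x‖ ≤ |B| := (hB x hx).trans (le_abs_self B)
    have hfxy : ‖f x - f y‖ ≤ C * dist x y := dist_eq_norm (f x) (f y) ▸ hC.dist_le_mul x y
    by_cases hy : y ∈ tsupport f
    · have hfy : ‖f y‖ ≤ |A| := (hA y hy).trans (le_abs_self A)
      have hgxy : ‖g x - g y‖ ≤ D * dist x y :=
        dist_eq_norm (g x) (g y) ▸ hg.dist_le_mul x hx y hy
      calc ‖f x * g x - f y * g y‖ = ‖f y * (g x - g y) + g x * (f x - f y)‖ := by ring_nf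
        _ ≤ ‖f y‖ * ‖g x - g y‖ + ‖g x‖ * ‖f x - f y‖ := by
            simpa only [norm_mul] using norm_add_le (f y * (g x - g y)) (g x * (f x - f y))
        _ ≤ |A| * (D * dist x y) + |B| * (C * dist x y) := by gcongr
        _ = (|A| * D + |B| * C) * dist x y := by ring
    · rw [image_eq_zero_of_notMem_tsupport hy, sub_zero] at hfxy
      rw [image_eq_zero_of_notMem_tsupport hy, zero_mul, sub_zero, norm_mul, mul_comm]
      calc ‖g x‖ * ‖f x‖ ≤ |B| * (C * dist x y) := by gcongr
        _ ≤ (|A| * D + |B| * C) * dist x y := by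
            rw [← mul_assoc]
            gcongr
            exact le_add_of_nonneg_left (by positivity)
  refine ⟨⟨(|A| * D + |B| * C).toNNReal, LipschitzWith.of_dist_le_mul fun x y => ?_⟩,
    hf.hasCompactSupport.mul_right⟩
  rw [Real.coe_toNNReal _ (by positivity), dist_eq_norm]
  by_cases hx : x ∈ tsupport f
  · exact hleft hx
  by_cases hy : y ∈ tsupport f
  · rw [norm_sub_rev, dist_comm]
    exact hleft hy
  · rw [image_eq_zero_of_notMem_tsupport hx, image_eq_zero_of_notMem_tsupport hy]
    simpa using by positivity

theorem mul (hf : IsCompactLipschitz f) (hg : IsCompactLipschitz g) :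
    IsCompactLipschitz fun x => f x * g x :=
  hf.mul_of_lipschitzOnWith hg.exists_lipschitzWith.choose_spec.lipschitzOnWith

theorem mul_comp_of_contDiffOn {C : NNReal} {δ : E → ℝ} {h : ℝ → ℝ} {J : Set ℝ}
    (hf : IsCompactLipschitz f) (hδ : LipschitzWith C δ) (hh : ContDiffOn ℝ 1 h J)
    (hJ : J.OrdConnected) (hmaps : MapsTo δ (tsupport f) J) :
    IsCompactLipschitz fun x => f x * h (δ x) := by
  rcases (tsupport f).eq_empty_or_nonempty with hempty | hne
  · exact hf.mul_of_lipschitzOnWith (D := 0) (hempty ▸ lipschitzOnWith_empty _ _)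
  have himage : IsCompact (δ '' tsupport f) :=
    hf.hasCompactSupport.isCompact.image hδ.continuous
  obtain ⟨a, ha⟩ := himage.exists_isLeast (hne.image δ)
  obtain ⟨b, hb⟩ := himage.exists_isGreatest (hne.image δ)
  have hIcc : Icc a b ⊆ J := hJ.out (hmaps.image_subset ha.1) (hmaps.image_subset hb.1)
  obtain ⟨D, hD⟩ := (hh.mono hIcc).exists_lipschitzOnWith one_ne_zero (convex_Icc a b)
    isCompact_Icc
  exact hf.mul_of_lipschitzOnWith (hD.comp hδ.lipschitzOnWith fun x hx =>
    ⟨ha.2 (mem_image_of_mem δ hx), hb.2 (mem_image_of_mem δ hx)⟩)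

theorem integrable [MeasurableSpace E] [BorelSpace E] {μ : Measure E}
    [IsFiniteMeasureOnCompacts μ] (hf : IsCompactLipschitz f) : Integrable f μ :=
  hf.continuous.integrable_of_hasCompactSupport hf.hasCompactSupport

end IsCompactLipschitz

theorem integral_sub_mul_sub_eq_neg_integral {E : Type*} [NormedAddCommGroup E] [MeasurableSpace E]
    [BorelSpace E] {μ : Measure E} [IsFiniteMeasureOnCompacts μ] [μ.IsAddRightInvariant]
    {δ η : E → ℝ} (hδ : Continuous δ) (hη : Continuous η) (hc : HasCompactSupport η) (w : E) :
    ∫ x, (δ (x + w) - δ x) * (η (x + w) - η x) ∂μ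
      = -∫ x, (δ (x + w) + δ (x - w) - 2 * δ x) * η x ∂μ := by
  have hshift : ∫ x, (δ (x + w) - δ x) * η (x + w) ∂μ = ∫ x, (δ x - δ (x - w)) * η x ∂μ := by
    rw [← integral_add_right_eq_self (fun x => (δ x - δ (x - w)) * η x) w]
    simp only [add_sub_cancel_right]
  have hi {a : E → ℝ} (ha : Continuous a) : Integrable (fun x => a x * η x) μ :=
    (ha.mul hη).integrable_of_hasCompactSupport hc.mul_left
  have hi' : Integrable (fun x => (δ (x + w) - δ x) * η (x + w)) μ :=
    Continuous.integrable_of_hasCompactSupport (by fun_prop)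
      (hc.comp_homeomorph (Homeomorph.addRight w)).mul_left
  simp_rw [mul_sub]
  rw [integral_sub hi' (hi (by fun_prop)), hshift,
    ← integral_sub (hi (by fun_prop)) (hi (by fun_prop)), ← integral_neg]
  refine integral_congr_ae (Eventually.of_forall fun x => ?_)
  ring

section LineDerivative

variable {E : Type*} [NormedAddCommGroup E] [NormedSpace ℝ E]

theorem lineDeriv_eq_zero_of_notMem_tsupport {f : E → ℝ} {x : E} (hx : x ∉ tsupport f) (v : E) :
    lineDeriv ℝ f x v = 0 := by
  rw [(notMem_tsupport_iff_eventuallyEq.1 hx).lineDeriv_eq]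
  simp [lineDeriv]

theorem contDiff_lineDeriv {u : E → ℝ} {n : WithTop ℕ∞} (hu : ContDiff ℝ (n + 1) u) (v : E) :
    ContDiff ℝ n fun x => lineDeriv ℝ u x v := by
  have hfderiv : (fun x => lineDeriv ℝ u x v) = fun x => fderiv ℝ u x v :=
    funext fun x => (hu.differentiable (by simp) x).lineDeriv_eq_fderiv
  rw [hfderiv]
  exact (hu.fderiv_right le_rfl).clm_apply contDiff_const

theorem hasCompactSupport_lineDeriv {u : E → ℝ} (hc : HasCompactSupport u) (v : E) :
    HasCompactSupport fun x => lineDeriv ℝ u x v :=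
  hc.mono' fun _ => Function.mtr fun hx =>
    Function.notMem_support.2 (lineDeriv_eq_zero_of_notMem_tsupport hx v)

theorem isCompactLipschitz_lineDeriv {u : E → ℝ} (hu : ContDiff ℝ 2 u) (hc : HasCompactSupport u)
    (v : E) : IsCompactLipschitz fun x => lineDeriv ℝ u x v :=
  .of_contDiff (contDiff_lineDeriv hu v) (hasCompactSupport_lineDeriv hc v)

theorem norm_inv_smul_sub_le_of_lipschitzWith {C : NNReal} {f : E → ℝ} (hf : LipschitzWith C f)
    {t : ℝ} (ht : 0 < t) (x v : E) : ‖t⁻¹ • (f (x + t • v) - f x)‖ ≤ C * ‖v‖ := by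
  rw [norm_smul, norm_inv, inv_mul_le_iff₀ (norm_pos_iff.2 ht.ne'), mul_left_comm, ← norm_smul]
  simpa using hf.norm_sub_le (x + t • v) x

variable [MeasurableSpace E] [BorelSpace E] [FiniteDimensional ℝ E]
  {μ : Measure E} [μ.IsAddHaarMeasure]

theorem integrable_lineDeriv {f : E → ℝ} (hf : IsCompactLipschitz f) (v : E) :
    Integrable (fun x => lineDeriv ℝ f x v) μ := by
  obtain ⟨C, hC⟩ := hf.exists_lipschitzWith
  exact (integrableOn_iff_integrable_of_support_subset fun x => Function.mtr fun hx =>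
    Function.notMem_support.2 (lineDeriv_eq_zero_of_notMem_tsupport hx v)).1
    ((hC.locallyIntegrable_lineDeriv v).integrableOn_isCompact hf.hasCompactSupport)

theorem integrable_lineDeriv_mul_lineDeriv {C : NNReal} {f g : E → ℝ} (hf : LipschitzWith C f)
    (hg : IsCompactLipschitz g) (v w : E) :
    Integrable (fun x => lineDeriv ℝ f x v * lineDeriv ℝ g x w) μ :=
  (integrable_lineDeriv hg w).bdd_mul (aestronglyMeasurable_lineDeriv hf.continuous μ)
    (Eventually.of_forall fun _ => norm_lineDeriv_le_of_lipschitz ℝ hf)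

theorem tendsto_integral_slope_mul_slope {C : NNReal} {δ η : E → ℝ} (hδ : LipschitzWith C δ)
    (hη : IsCompactLipschitz η) (v : E) :
    Tendsto (fun t : ℝ =>
        ∫ x, (t⁻¹ • (δ (x + t • v) - δ x)) * (t⁻¹ • (η (x + t • v) - η x)) ∂μ)
      (𝓝[>] 0) (𝓝 (∫ x, lineDeriv ℝ δ x v * lineDeriv ℝ η x v ∂μ)) := by
  obtain ⟨D, hD⟩ := hη.exists_lipschitzWith
  have hδc := hδ.continuous
  have hηc := hη.continuous
  have hK : IsCompact (Metric.cthickening ‖v‖ (tsupport η)) := hη.hasCompactSupport.cthickening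
  apply tendsto_integral_filter_of_dominated_convergence
    ((Metric.cthickening ‖v‖ (tsupport η)).indicator fun _ => (C * ‖v‖) * (D * ‖v‖))
  · exact Eventually.of_forall fun t => Continuous.aestronglyMeasurable (by fun_prop)
  · filter_upwards [Ioc_mem_nhdsGT zero_lt_one] with t ht
    refine Eventually.of_forall fun x => ?_
    by_cases hx : x ∈ Metric.cthickening ‖v‖ (tsupport η)
    · rw [indicator_of_mem hx, norm_mul]
      exact mul_le_mul (norm_inv_smul_sub_le_of_lipschitzWith hδ ht.1 x v)
        (norm_inv_smul_sub_le_of_lipschitzWith hD ht.1 x v) (norm_nonneg _) (by positivity)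
    · have hηx : η x = 0 := image_eq_zero_of_notMem_tsupport fun h =>
        hx (Metric.self_subset_cthickening _ h)
      have hηxt : η (x + t • v) = 0 := image_eq_zero_of_notMem_tsupport fun h => by
        refine hx (Metric.mem_cthickening_of_dist_le _ _ _ _ h ?_)
        rw [dist_self_add_right, norm_smul, Real.norm_of_nonneg ht.1.le]
        exact mul_le_of_le_one_left (norm_nonneg v) ht.2
      rw [hηx, hηxt, indicator_of_notMem hx, sub_zero, smul_zero, mul_zero, norm_zero]
  · exact (integrable_indicator_iff hK.measurableSet).2
      (continuousOn_const.integrableOn_compact hK)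
  · filter_upwards [hδ.ae_lineDifferentiableAt (μ := μ) v,
      hD.ae_lineDifferentiableAt (μ := μ) v] with x hxδ hxη
    exact hxδ.hasLineDerivAt.tendsto_slope_zero_right.mul
      hxη.hasLineDerivAt.tendsto_slope_zero_right

/-- Second differences of `δ` bounded above by `κ t²` give `∂ᵥ∂ᵥδ ≤ κ` in the weak sense. -/
theorem neg_mul_integral_le_integral_lineDeriv_mul_lineDeriv {C : NNReal} {δ η : E → ℝ}
    (hδ : LipschitzWith C δ) (hη : IsCompactLipschitz η) (hη0 : ∀ x, 0 ≤ η x) {v : E} {κ : ℝ}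
    (hsecond : ∀ᶠ t in 𝓝[>] (0 : ℝ), ∀ x ∈ tsupport η,
      δ (x + t • v) + δ (x - t • v) - 2 * δ x ≤ κ * t ^ 2) :
    -κ * ∫ x, η x ∂μ ≤ ∫ x, lineDeriv ℝ δ x v * lineDeriv ℝ η x v ∂μ := by
  have hδc := hδ.continuous
  have hηc := hη.continuous
  refine ge_of_tendsto (tendsto_integral_slope_mul_slope hδ hη v) ?_
  filter_upwards [hsecond, self_mem_nhdsWithin] with t hle (ht : 0 < t)
  have hbound : ∫ x, (δ (x + t • v) + δ (x - t • v) - 2 * δ x) * η x ∂μ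
      ≤ κ * t ^ 2 * ∫ x, η x ∂μ := by
    rw [← integral_const_mul]
    refine integral_mono (Continuous.integrable_of_hasCompactSupport (by fun_prop)
      hη.hasCompactSupport.mul_left) (hη.integrable.const_mul _) fun x => ?_
    by_cases hx : x ∈ tsupport η
    · exact mul_le_mul_of_nonneg_right (hle x hx) (hη0 x)
    · simp [image_eq_zero_of_notMem_tsupport hx]
  have hscale : ∫ x, (t⁻¹ • (δ (x + t • v) - δ x)) * (t⁻¹ • (η (x + t • v) - η x)) ∂μ
      = (t ^ 2)⁻¹ * ∫ x, (δ (x + t • v) - δ x) * (η (x + t • v) - η x) ∂μ := by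
    rw [← integral_const_mul]
    refine integral_congr_ae (Eventually.of_forall fun x => ?_)
    simp only [smul_eq_mul]
    ring
  rw [hscale, integral_sub_mul_sub_eq_neg_integral hδc hηc hη.hasCompactSupport,
    ← div_eq_inv_mul, le_div_iff₀ (by positivity)]
  linarith

end LineDerivative

end LipschitzCalculus

section GradientCalculus

variable {E : Type*} [NormedAddCommGroup E] [InnerProductSpace ℝ E] [CompleteSpace E]
  {f g : E → ℝ} {f' g' x : E}

theorem hasGradientAt_mul (hf : HasGradientAt f f' x) (hg : HasGradientAt g g' x) :
    HasGradientAt (fun y => f y * g y) (f x • g' + g x • f') x := by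
  rw [hasGradientAt_iff_hasFDerivAt] at *
  rw [map_add, map_smulₛₗ, map_smulₛₗ]
  exact hf.mul hg

theorem hasGradientAt_comp {h : ℝ → ℝ} {h' : ℝ} (hh : HasDerivAt h h' (f x))
    (hf : HasGradientAt f f' x) : HasGradientAt (fun y => h (f y)) (h' • f') x := by
  rw [hasGradientAt_iff_hasFDerivAt] at *
  rw [map_smulₛₗ]
  exact hh.comp_hasFDerivAt x hf

theorem norm_gradient_mul_sq (hf : DifferentiableAt ℝ f x) (hg : DifferentiableAt ℝ g x) :
    ‖gradient (fun y => f y * g y) x‖ ^ 2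
      = inner ℝ (gradient g x) (gradient (fun y => f y * f y * g y) x)
        + ‖gradient f x‖ ^ 2 * g x ^ 2 := by
  rw [(hasGradientAt_mul hf.hasGradientAt hg.hasGradientAt).gradient,
    (hasGradientAt_mul (hasGradientAt_mul hf.hasGradientAt hf.hasGradientAt)
      hg.hasGradientAt).gradient, ← real_inner_self_eq_norm_sq, ← real_inner_self_eq_norm_sq]
  simp only [inner_add_left, inner_add_right, real_inner_smul_left, real_inner_smul_right,
    real_inner_comm (gradient g x)]
  ring

theorem norm_gradient_eq_norm_fderiv (f : E → ℝ) (x : E) : ‖gradient f x‖ = ‖fderiv ℝ f x‖ :=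
  (InnerProductSpace.toDual ℝ E).symm.norm_map _

theorem norm_gradient_le_of_lipschitzWith {C : NNReal} (hf : LipschitzWith C f) (x : E) :
    ‖gradient f x‖ ≤ C :=
  (norm_gradient_eq_norm_fderiv f x).trans_le (norm_fderiv_le_of_lipschitz ℝ hf)

theorem gradient_eq_zero_of_notMem_tsupport (hx : x ∉ tsupport f) : gradient f x = 0 := by
  rw [(notMem_tsupport_iff_eventuallyEq.1 hx).gradient_eq]
  exact gradient_const x 0

theorem measurable_gradient [FiniteDimensional ℝ E] [MeasurableSpace E] [BorelSpace E]
    (f : E → ℝ) : Measurable (gradient f) :=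
  (InnerProductSpace.toDual ℝ E).symm.continuous.measurable.comp (measurable_fderiv ℝ f)

variable {ι : Type*} [Fintype ι]

theorem inner_gradient_eq_sum_lineDeriv (b : OrthonormalBasis ι ℝ E)
    (hf : DifferentiableAt ℝ f x) (hg : DifferentiableAt ℝ g x) :
    inner ℝ (gradient f x) (gradient g x)
      = ∑ i, lineDeriv ℝ f x (b i) * lineDeriv ℝ g x (b i) := by
  rw [← b.sum_inner_mul_inner]
  refine Finset.sum_congr rfl fun i _ => ?_
  rw [inner_gradient_left, inner_gradient_right, hf.lineDeriv_eq_fderiv, hg.lineDeriv_eq_fderiv]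
  rfl

variable [FiniteDimensional ℝ E] [MeasurableSpace E] [BorelSpace E]

theorem integrable_inner_gradient {C : NNReal} (hf : LipschitzWith C f)
    (hg : IsCompactLipschitz g) :
    Integrable fun x => inner ℝ (gradient f x) (gradient g x) := by
  obtain ⟨D, hD⟩ := hg.exists_lipschitzWith
  have hon : IntegrableOn (fun x => inner ℝ (gradient f x) (gradient g x)) (tsupport g) := by
    refine Measure.integrableOn_of_bounded (M := C * D)
      hg.hasCompactSupport.isCompact.measure_lt_top.ne
      ((measurable_gradient f).inner (measurable_gradient g)).aestronglyMeasurable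
      (Eventually.of_forall fun x => (norm_inner_le_norm _ _).trans ?_)
    gcongr
    exacts [norm_gradient_le_of_lipschitzWith hf x, norm_gradient_le_of_lipschitzWith hD x]
  refine (integrableOn_iff_integrable_of_support_subset fun x => Function.mtr fun hx => ?_).1 hon
  rw [Function.notMem_support, gradient_eq_zero_of_notMem_tsupport hx, inner_zero_right]

theorem integral_inner_gradient_eq_sum {C : NNReal} (b : OrthonormalBasis ι ℝ E)
    (hf : LipschitzWith C f) (hg : IsCompactLipschitz g) :
    ∫ x, inner ℝ (gradient f x) (gradient g x)
      = ∑ i, ∫ x, lineDeriv ℝ f x (b i) * lineDeriv ℝ g x (b i) := by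
  obtain ⟨D, hD⟩ := hg.exists_lipschitzWith
  rw [← integral_finsetSum _ fun i _ => integrable_lineDeriv_mul_lineDeriv hf hg _ _]
  refine integral_congr_ae ?_
  filter_upwards [hf.ae_differentiableAt, hD.ae_differentiableAt] with x hxf hxg
  exact inner_gradient_eq_sum_lineDeriv b hxf hxg

theorem integrable_norm_gradient_sq (hf : IsCompactLipschitz f) :
    Integrable fun x => ‖gradient f x‖ ^ 2 := by
  obtain ⟨C, hC⟩ := hf.exists_lipschitzWith
  simpa only [real_inner_self_eq_norm_sq] using integrable_inner_gradient hC hf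

end GradientCalculus

section GreenIdentity

variable {E : Type*} [NormedAddCommGroup E] [InnerProductSpace ℝ E] [FiniteDimensional ℝ E]
  {u w : E → ℝ}

theorem laplacian_eq_sum_lineDeriv {ι : Type*} [Fintype ι] (b : OrthonormalBasis ι ℝ E)
    (hu : ContDiff ℝ 2 u) (x : E) :
    Laplacian.laplacian u x = ∑ i, lineDeriv ℝ (fun y => lineDeriv ℝ u y (b i)) x (b i) := by
  rw [InnerProductSpace.laplacian_eq_iteratedFDeriv_orthonormalBasis u b]
  refine Finset.sum_congr rfl fun i _ => ?_
  have hfderiv : (fun y => lineDeriv ℝ u y (b i)) = fun y => fderiv ℝ u y (b i) :=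
    funext fun y => (hu.differentiable two_ne_zero y).lineDeriv_eq_fderiv
  have hd : DifferentiableAt ℝ (fderiv ℝ u) x :=
    (hu.fderiv_right (m := 1) (by norm_num)).differentiable one_ne_zero x
  rw [iteratedFDeriv_two_apply, hfderiv,
    ((hd.hasFDerivAt.clm_apply (hasFDerivAt_const (b i) x)).hasLineDerivAt (b i)).lineDeriv]
  simp

variable [MeasurableSpace E] [BorelSpace E]

theorem integral_inner_gradient_eq_neg_integral_mul_laplacian (hu : ContDiff ℝ 2 u)
    (hc : HasCompactSupport u) (hw : IsCompactLipschitz w) :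
    ∫ x, inner ℝ (gradient u x) (gradient w x) = -∫ x, w x * Laplacian.laplacian u x := by
  let b := stdOrthonormalBasis ℝ E
  obtain ⟨C, hC⟩ := (IsCompactLipschitz.of_contDiff (hu.of_le one_le_two) hc).exists_lipschitzWith
  obtain ⟨D, hD⟩ := hw.exists_lipschitzWith
  have hu' (i) := isCompactLipschitz_lineDeriv hu hc (b i)
  have hterm (i) : ∫ x, lineDeriv ℝ u x (b i) * lineDeriv ℝ w x (b i)
      = -∫ x, w x * lineDeriv ℝ (fun y => lineDeriv ℝ u y (b i)) x (b i) := by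
    obtain ⟨C', hC'⟩ := (hu' i).exists_lipschitzWith
    have hparts := hC'.integral_lineDeriv_mul_eq (μ := volume) hD hw.hasCompactSupport (b i)
    simp only [lineDeriv_neg, neg_mul, integral_neg, mul_comm _ (w _)] at hparts
    simp only [hparts, neg_neg, mul_comm]
  have hint (i) :
      Integrable fun x => w x * lineDeriv ℝ (fun y => lineDeriv ℝ u y (b i)) x (b i) := by
    obtain ⟨B, hB⟩ := hw.hasCompactSupport.exists_bound_of_continuous hw.continuous
    exact (integrable_lineDeriv (hu' i) (b i)).bdd_mul hw.continuous.aestronglyMeasurable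
      (Eventually.of_forall hB)
  simp only [laplacian_eq_sum_lineDeriv b hu, Finset.mul_sum]
  rw [integral_inner_gradient_eq_sum b hC hw, integral_finsetSum _ fun i _ => hint i,
    ← Finset.sum_neg_distrib]
  exact Finset.sum_congr rfl fun i _ => hterm i

end GreenIdentity

section Hardy

theorem integrable_mul_of_integrableOn_tsupport {X : Type*} [TopologicalSpace X] [T2Space X]
    [MeasurableSpace X] [OpensMeasurableSpace X] {μ : Measure X} {W f : X → ℝ}
    (hW : IntegrableOn W (tsupport f) μ) (hf : Continuous f) (hc : HasCompactSupport f) :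
    Integrable (fun x => W x * f x) μ :=
  (integrableOn_iff_integrable_of_support_subset
    ((Function.support_mul_subset_right W f).trans (subset_tsupport f))).1
    (hW.mul_continuousOn hf.continuousOn hc)

/-- The solution `h(t) = 1/(2t) - K/(2(1 + Kt))` of a Riccati inequality, which calibrates the
Hardy inequality on a domain whose distance function satisfies `Δδ ≤ K`. -/
noncomputable def hardyWeight (K t : ℝ) : ℝ := 1 / (2 * t * (1 + K * t))

theorem hardyWeight_nonneg {K t : ℝ} (hK : 0 ≤ K) (ht : 0 ≤ t) : 0 ≤ hardyWeight K t := by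
  unfold hardyWeight
  positivity

theorem hasDerivAt_hardyWeight {K t : ℝ} (hK : 0 ≤ K) (ht : 0 < t) :
    HasDerivAt (hardyWeight K) (-(1 + 2 * K * t) / (2 * t ^ 2 * (1 + K * t) ^ 2)) t := by
  have : 0 < 1 + K * t := by positivity
  have hden : HasDerivAt (fun t : ℝ => 2 * t * (1 + K * t)) (2 * (1 + K * t) + 2 * t * K) t := by
    simpa using
      ((hasDerivAt_id' t).const_mul 2).fun_mul (((hasDerivAt_id' t).const_mul K).const_add 1)
  refine ((hasDerivAt_const t (1 : ℝ)).div hden (by positivity)).congr_deriv ?_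
  field_simp
  ring

theorem contDiffOn_hardyWeight {K : ℝ} (hK : 0 ≤ K) :
    ContDiffOn ℝ 1 (hardyWeight K) (Ioi 0) := by
  refine contDiffOn_const.div (by fun_prop) fun t (ht : 0 < t) => ?_
  positivity

theorem hardyWeight_riccati {K t : ℝ} (hK : 0 ≤ K) (ht : 0 < t) :
    1 / 4 * (1 / t ^ 2) - 3 / 4 * K ^ 2
      ≤ -deriv (hardyWeight K) t - hardyWeight K t ^ 2 - K * hardyWeight K t := by
  have : 0 < 1 + K * t := by positivity
  have hexact : -deriv (hardyWeight K) t - hardyWeight K t ^ 2 - K * hardyWeight K t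
      = 1 / 4 * (1 / t ^ 2) - 3 / 4 * (K / (1 + K * t)) ^ 2 := by
    rw [(hasDerivAt_hardyWeight hK ht).deriv, hardyWeight]
    field_simp
    ring
  have hle : K / (1 + K * t) ≤ K := div_le_self hK (le_add_of_nonneg_right (by positivity))
  rw [hexact]
  gcongr

variable {E : Type*} [NormedAddCommGroup E] [InnerProductSpace ℝ E]
  {Ω : Set E} {ρ : ℝ}

/-- The potential `1/(4δ²) - ¾ (n/ρ)²` in the Hardy inequality of a domain with exterior balls of
radius `ρ`, where `δ` is the distance to the complement and `n` the dimension. -/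
noncomputable def hardyPotential (Ω : Set E) (ρ : ℝ) (x : E) : ℝ :=
  1 / 4 * (1 / Metric.infDist x Ωᶜ ^ 2) - 3 / 4 * (Module.finrank ℝ E / ρ) ^ 2

theorem continuousOn_hardyPotential (hΩ : IsOpen Ω) (hne : Ω ≠ univ) :
    ContinuousOn (hardyPotential Ω ρ) Ω := by
  have : Continuous fun x => Metric.infDist x Ωᶜ := Metric.continuous_infDist_pt _
  have : ∀ x ∈ Ω, Metric.infDist x Ωᶜ ^ 2 ≠ 0 := fun x hx =>
    pow_ne_zero 2 (infDist_compl_pos hΩ hne hx).ne'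
  unfold hardyPotential
  fun_prop (disch := assumption)

variable [FiniteDimensional ℝ E]

theorem hardyPotential_mul_sq_add_le_norm_gradient_sq (hΩ : IsOpen Ω) (hne : Ω ≠ univ)
    (hρ : 0 ≤ ρ) {g : E → ℝ} {x : E} (hx : x ∈ Ω)
    (hδd : DifferentiableAt ℝ (fun y => Metric.infDist y Ωᶜ) x) (hgd : DifferentiableAt ℝ g x) :
    hardyPotential Ω ρ x * g x ^ 2
      + Module.finrank ℝ E / ρ
        * (g x * g x * hardyWeight (Module.finrank ℝ E / ρ) (Metric.infDist x Ωᶜ))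
      + inner ℝ (gradient (fun y => Metric.infDist y Ωᶜ) x) (gradient (fun y =>
        g y * g y * hardyWeight (Module.finrank ℝ E / ρ) (Metric.infDist y Ωᶜ)) x)
      ≤ ‖gradient g x‖ ^ 2 := by
  set K : ℝ := Module.finrank ℝ E / ρ
  set δ : E → ℝ := fun y => Metric.infDist y Ωᶜ
  have hK : 0 ≤ K := by positivity
  have hδx : 0 < δ x := infDist_compl_pos hΩ hne hx
  have hη := hasGradientAt_mul (hasGradientAt_mul hgd.hasGradientAt hgd.hasGradientAt)
    (hasGradientAt_comp (hasDerivAt_hardyWeight hK hδx).differentiableAt.hasDerivAt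
      hδd.hasGradientAt)
  have heikonal : inner ℝ (gradient δ x) (gradient δ x) = 1 := by
    rw [real_inner_self_eq_norm_sq, norm_gradient_eq_norm_fderiv,
      norm_fderiv_infDist_eq_one hΩ.isClosed_compl (nonempty_compl.2 hne) (not_not_intro hx) hδd,
      one_pow]
  have hsquare := sq_nonneg ‖gradient g x - (g x * hardyWeight K (δ x)) • gradient δ x‖
  have hriccati := mul_le_mul_of_nonneg_left (hardyWeight_riccati hK hδx) (sq_nonneg (g x))
  rw [← real_inner_self_eq_norm_sq] at hsquare ⊢
  rw [hη.gradient, hardyPotential]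
  simp only [inner_sub_left, inner_sub_right, inner_add_right, real_inner_smul_left,
    real_inner_smul_right, heikonal, real_inner_comm (gradient g x)] at hsquare ⊢
  linarith

variable [MeasurableSpace E] [BorelSpace E]

theorem neg_mul_integral_le_integral_inner_gradient_infDist (hΩ : IsOpen Ω) (hne : Ω ≠ univ)
    (hball : HasExteriorBalls Ω ρ) {η : E → ℝ} (hη : IsCompactLipschitz η)
    (hsupp : tsupport η ⊆ Ω) (hη0 : ∀ x, 0 ≤ η x) :
    -(Module.finrank ℝ E / ρ) * ∫ x, η x
      ≤ ∫ x, inner ℝ (gradient (fun y => Metric.infDist y Ωᶜ) x) (gradient η x) := by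
  let b := stdOrthonormalBasis ℝ E
  have hδ : LipschitzWith 1 fun y => Metric.infDist y Ωᶜ := Metric.lipschitz_infDist_pt Ωᶜ
  obtain ⟨s, hs, hlt⟩ := exists_pos_lt_infDist_compl hΩ hne hη.hasCompactSupport hsupp
  have hterm (i) : -(1 / ρ) * ∫ x, η x
      ≤ ∫ x, lineDeriv ℝ (fun y => Metric.infDist y Ωᶜ) x (b i) * lineDeriv ℝ η x (b i) := by
    refine neg_mul_integral_le_integral_lineDeriv_mul_lineDeriv hδ hη hη0 ?_
    filter_upwards [Ioc_mem_nhdsGT hs] with t ht x hx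
    have hnorm : ‖t • b i‖ = t := by
      rw [norm_smul, b.norm_eq_one, mul_one, Real.norm_of_nonneg ht.1.le]
    have hsub : Metric.ball x (Metric.infDist x Ωᶜ) ⊆ Ω := Metric.ball_infDist_compl_subset
    have hlt' : ‖t • b i‖ < Metric.infDist x Ωᶜ := hnorm.trans_lt (ht.2.trans_lt (hlt x hx))
    refine (infDist_compl_add_sub_le hΩ hne hball (hsupp hx) (hsub ?_) (hsub ?_)).trans_eq ?_
    · rwa [Metric.mem_ball, dist_self_add_left]
    · rwa [Metric.mem_ball, dist_self_sub_left]
    · rw [hnorm, div_eq_inv_mul, one_div]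
  calc -(Module.finrank ℝ E / ρ) * ∫ x, η x
      = ∑ _i : Fin (Module.finrank ℝ E), -(1 / ρ) * ∫ x, η x := by
        rw [Finset.sum_const, Finset.card_fin, nsmul_eq_mul]
        ring
    _ ≤ _ := Finset.sum_le_sum fun i _ => hterm i
    _ = _ := (integral_inner_gradient_eq_sum b hδ hη).symm

/-- The weak bound `Δδ ≤ n/ρ` is tested with `g² h(δ)`, where `h` is `hardyWeight`; completing the
square in `∇g - g h(δ) ∇δ` and `|∇δ| = 1` then leave exactly the Riccati inequality for `h`. -/
theorem integral_hardyPotential_mul_sq_le (hΩ : IsOpen Ω) (hne : Ω ≠ univ)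
    (hball : HasExteriorBalls Ω ρ) {g : E → ℝ} (hg : IsCompactLipschitz g)
    (hsupp : tsupport g ⊆ Ω) :
    ∫ x, hardyPotential Ω ρ x * g x ^ 2 ≤ ∫ x, ‖gradient g x‖ ^ 2 := by
  set K : ℝ := Module.finrank ℝ E / ρ
  have hK : 0 ≤ K := div_nonneg (Nat.cast_nonneg _) hball.radius_pos.le
  obtain ⟨C, hC⟩ := hg.exists_lipschitzWith
  have hδ : LipschitzWith 1 fun y => Metric.infDist y Ωᶜ := Metric.lipschitz_infDist_pt Ωᶜ
  have hgg : tsupport (fun x => g x * g x) ⊆ tsupport g := tsupport_mul_subset_left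
  let η : E → ℝ := fun x => g x * g x * hardyWeight K (Metric.infDist x Ωᶜ)
  have hηg : tsupport η ⊆ tsupport g := tsupport_mul_subset_left.trans hgg
  have hη : IsCompactLipschitz η :=
    (hg.mul hg).mul_comp_of_contDiffOn hδ (contDiffOn_hardyWeight hK) ordConnected_Ioi
      fun x hx => infDist_compl_pos hΩ hne (hsupp (hgg hx))
  have hη0 (x) : 0 ≤ η x :=
    mul_nonneg (mul_self_nonneg _) (hardyWeight_nonneg hK Metric.infDist_nonneg)
  have hpotential : Integrable fun x => hardyPotential Ω ρ x * g x ^ 2 := by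
    simp only [sq]
    exact integrable_mul_of_integrableOn_tsupport
      (((continuousOn_hardyPotential hΩ hne).mono (hgg.trans hsupp)).integrableOn_compact
        (hg.mul hg).hasCompactSupport) (hg.mul hg).continuous (hg.mul hg).hasCompactSupport
  have hpointwise : ∀ᵐ x, hardyPotential Ω ρ x * g x ^ 2 + K * η x
      + inner ℝ (gradient (fun y => Metric.infDist y Ωᶜ) x) (gradient η x)
      ≤ ‖gradient g x‖ ^ 2 := by
    filter_upwards [hδ.ae_differentiableAt, hC.ae_differentiableAt] with x hxδ hxg
    by_cases hx : x ∈ tsupport g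
    · exact hardyPotential_mul_sq_add_le_norm_gradient_sq hΩ hne hball.radius_pos.le (hsupp hx)
        hxδ hxg
    · rw [gradient_eq_zero_of_notMem_tsupport (notMem_subset hηg hx),
        image_eq_zero_of_notMem_tsupport (notMem_subset hηg hx),
        image_eq_zero_of_notMem_tsupport hx]
      simp
  have hweak := neg_mul_integral_le_integral_inner_gradient_infDist hΩ hne hball hη
    (hηg.trans hsupp) hη0
  have hsum := integral_mono_ae ((hpotential.add (hη.integrable.const_mul K)).add
    (integrable_inner_gradient hδ hη)) (integrable_norm_gradient_sq hg) hpointwise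
  rw [integral_add' (hpotential.add (hη.integrable.const_mul K)) (integrable_inner_gradient hδ hη),
    integral_add' hpotential (hη.integrable.const_mul K), integral_const_mul] at hsum
  linarith

theorem integral_hardyPotential_mul_sq_add_le (hΩ : IsOpen Ω) (hne : Ω ≠ univ)
    (hball : HasExteriorBalls Ω ρ) {u : E → ℝ} (hu : ContDiff ℝ 2 u) (huc : HasCompactSupport u)
    {f : E → ℝ} (hf : IsCompactLipschitz f) (hsupp : tsupport f ⊆ Ω) :
    (∫ x, hardyPotential Ω ρ x * (f x * u x) ^ 2)
        + ∫ x, f x * f x * u x * Laplacian.laplacian u x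
      ≤ ∫ x, ‖gradient f x‖ ^ 2 * u x ^ 2 := by
  have huL : IsCompactLipschitz u := .of_contDiff (hu.of_le one_le_two) huc
  obtain ⟨C, hC⟩ := huL.exists_lipschitzWith
  obtain ⟨D, hD⟩ := hf.exists_lipschitzWith
  have hffu := (hf.mul hf).mul huL
  have hhardy := integral_hardyPotential_mul_sq_le hΩ hne hball (hf.mul huL)
    (tsupport_mul_subset_left.trans hsupp)
  have hsplit : (fun x => ‖gradient (fun y => f y * u y) x‖ ^ 2) =ᵐ[volume]
      fun x => inner ℝ (gradient u x) (gradient (fun y => f y * f y * u y) x)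
        + ‖gradient f x‖ ^ 2 * u x ^ 2 := by
    filter_upwards [hD.ae_differentiableAt] with x hx
    exact norm_gradient_mul_sq hx (hu.differentiable two_ne_zero x)
  have hint : Integrable fun x => ‖gradient f x‖ ^ 2 * u x ^ 2 := by
    refine ((integrable_norm_gradient_sq (hf.mul huL)).sub
      (integrable_inner_gradient hC hffu)).congr ?_
    filter_upwards [hsplit] with x hx
    rw [Pi.sub_apply, hx, add_sub_cancel_left]
  rw [integral_congr_ae hsplit, integral_add (integrable_inner_gradient hC hffu) hint,
    integral_inner_gradient_eq_neg_integral_mul_laplacian hu huc hffu] at hhardy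
  linarith

end Hardy

section SquareIntegrable

variable {α β : Type*} [MeasurableSpace α] {μ : Measure α} {l : Filter β} {u v : α → ℝ}
  {U V : β → α → ℝ}

theorem tendsto_integral_mul (hU : ∀ k, MemLp (U k) 2 μ) (hu : MemLp u 2 μ)
    (hV : ∀ k, MemLp (V k) 2 μ) (hv : MemLp v 2 μ)
    (hUu : Tendsto (fun k => eLpNorm (U k - u) 2 μ) l (𝓝 0))
    (hVv : Tendsto (fun k => eLpNorm (V k - v) 2 μ) l (𝓝 0)) :
    Tendsto (fun k => ∫ x, U k x * V k x ∂μ) l (𝓝 (∫ x, u x * v x ∂μ)) := by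
  have hinner {f g : α → ℝ} (hf : MemLp f 2 μ) (hg : MemLp g 2 μ) :
      inner ℝ (hf.toLp f) (hg.toLp g) = ∫ x, f x * g x ∂μ := by
    rw [L2.inner_def]
    refine integral_congr_ae ?_
    filter_upwards [hf.coeFn_toLp, hg.coeFn_toLp] with x hfx hgx
    rw [hfx, hgx, Real.inner_apply]
  have hUl := (Lp.tendsto_Lp_iff_tendsto_eLpNorm'' U hU u hu).2 hUu
  have hVl := (Lp.tendsto_Lp_iff_tendsto_eLpNorm'' V hV v hv).2 hVv
  simpa only [hinner] using hUl.inner (𝕜 := ℝ) hVl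

theorem integrable_mul_mul_of_memLp {B : α → ℝ} (hB : MemLp B ∞ μ) (hu : MemLp u 2 μ)
    (hv : MemLp v 2 μ) : Integrable (fun x => B x * (u x * v x)) μ := by
  refine ((hu.mul hB (r := 2)).integrable_mul hv).congr (Eventually.of_forall fun x => ?_)
  simp only [Pi.mul_apply, mul_assoc]

theorem tendsto_integral_mul_mul {B : α → ℝ} (hB : MemLp B ∞ μ) (hU : ∀ k, MemLp (U k) 2 μ)
    (hu : MemLp u 2 μ) (hV : ∀ k, MemLp (V k) 2 μ) (hv : MemLp v 2 μ)
    (hUu : Tendsto (fun k => eLpNorm (U k - u) 2 μ) l (𝓝 0))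
    (hVv : Tendsto (fun k => eLpNorm (V k - v) 2 μ) l (𝓝 0)) :
    Tendsto (fun k => ∫ x, B x * (U k x * V k x) ∂μ) l (𝓝 (∫ x, B x * (u x * v x) ∂μ)) := by
  have hBUu : Tendsto (fun k => eLpNorm (B * U k - B * u) 2 μ) l (𝓝 0) := by
    refine tendsto_of_tendsto_of_tendsto_of_le_of_le tendsto_const_nhds
      (by simpa using ENNReal.Tendsto.const_mul hUu (Or.inr hB.eLpNorm_ne_top))
      (fun k => zero_le) fun k => ?_
    rw [← mul_sub]
    exact eLpNorm_smul_le_eLpNorm_top_mul_eLpNorm 2 ((hU k).sub hu).aestronglyMeasurable B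
  simpa only [Pi.mul_apply, mul_assoc] using
    tendsto_integral_mul (fun k => (hU k).mul hB) (hu.mul hB) hV hv hBUu hVv

end SquareIntegrable

section Mollification

open ContinuousLinearMap
open scoped Convolution

theorem lineDeriv_comp_const_sub {E : Type*} [NormedAddCommGroup E] [NormedSpace ℝ E]
    (η : E → ℝ) (x t v : E) :
    lineDeriv ℝ (fun y => η (x - y)) t v = -lineDeriv ℝ η (x - t) v := by
  rw [← lineDeriv_neg]
  simp only [lineDeriv, smul_neg, ← sub_eq_add_neg, sub_sub]

variable {E : Type*} [NormedAddCommGroup E] [InnerProductSpace ℝ E] [FiniteDimensional ℝ E]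

theorem laplacian_comp_const_sub {η : E → ℝ} (hη : ContDiff ℝ 2 η) (x t : E) :
    Laplacian.laplacian (fun y => η (x - y)) t = Laplacian.laplacian η (x - t) := by
  let b := stdOrthonormalBasis ℝ E
  have hneg (f : E → ℝ) (v : E) : lineDeriv ℝ (fun y => -f y) t v = -lineDeriv ℝ f t v :=
    deriv.fun_neg
  have hη' : ContDiff ℝ 2 fun y => η (x - y) := hη.comp (contDiff_const.sub contDiff_id)
  rw [laplacian_eq_sum_lineDeriv b hη', laplacian_eq_sum_lineDeriv b hη]
  refine Finset.sum_congr rfl fun i _ => ?_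
  simp only [lineDeriv_comp_const_sub, hneg]
  rw [lineDeriv_comp_const_sub fun y => lineDeriv ℝ η y (b i), neg_neg]

variable [MeasurableSpace E] [BorelSpace E]

theorem lineDeriv_convolution_right {u η : E → ℝ} (hu : LocallyIntegrable u)
    (hη : ContDiff ℝ 1 η) (hc : HasCompactSupport η) (v : E) :
    (fun x => lineDeriv ℝ (u ⋆[lsmul ℝ ℝ, volume] η) x v) =
      u ⋆[lsmul ℝ ℝ, volume] fun y => lineDeriv ℝ η y v := by
  funext x
  rw [((hc.hasFDerivAt_convolution_right (lsmul ℝ ℝ) hu hη x).hasLineDerivAt v).lineDeriv,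
    convolution_precompR_apply _ hu (hc.fderiv ℝ) (hη.continuous_fderiv one_ne_zero)]
  simp only [(hη.differentiable one_ne_zero _).lineDeriv_eq_fderiv]

theorem laplacian_convolution_right {u η : E → ℝ} (hu : LocallyIntegrable u)
    (hη : ContDiff ℝ 2 η) (hc : HasCompactSupport η) (x : E) :
    Laplacian.laplacian (u ⋆[lsmul ℝ ℝ, volume] η) x =
      ∫ t, u t * Laplacian.laplacian η (x - t) := by
  let b := stdOrthonormalBasis ℝ E
  have hη' (i) : ContDiff ℝ 1 fun y => lineDeriv ℝ η y (b i) := contDiff_lineDeriv hη (b i)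
  have hc' (i) : HasCompactSupport fun y => lineDeriv ℝ η y (b i) :=
    hasCompactSupport_lineDeriv hc (b i)
  have hint (i) : Integrable fun t =>
      u t * lineDeriv ℝ (fun y => lineDeriv ℝ η y (b i)) (x - t) (b i) := by
    simpa only [ConvolutionExistsAt, lsmul_apply, smul_eq_mul] using
      (hasCompactSupport_lineDeriv (hc' i) (b i)).convolutionExists_right (lsmul ℝ ℝ) hu
        (contDiff_lineDeriv (n := 0) (hη' i) (b i)).continuous x
  rw [laplacian_eq_sum_lineDeriv b (hc.contDiff_convolution_right (n := 2) (lsmul ℝ ℝ) hu hη)]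
  simp only [laplacian_eq_sum_lineDeriv b hη, Finset.mul_sum,
    lineDeriv_convolution_right hu (hη.of_le one_le_two) hc]
  rw [integral_finsetSum _ fun i _ => hint i]
  refine Finset.sum_congr rfl fun i _ => ?_
  rw [congrFun (lineDeriv_convolution_right hu (hη' i) (hc' i) (b i)) x]
  simp only [convolution_def, lsmul_apply, smul_eq_mul]

/-- The regularization of `u` by convolution with the normalized bump function `φ`. -/
noncomputable def mollify (φ : ContDiffBump (0 : E)) (u : E → ℝ) : E → ℝ :=
  u ⋆[lsmul ℝ ℝ, volume] φ.normed volume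

variable (φ : ContDiffBump (0 : E)) {u v : E → ℝ}

theorem mollify_apply (u : E → ℝ) (x : E) :
    mollify φ u x = ∫ t, u t * φ.normed volume (x - t) := by
  simp only [mollify, convolution_def, lsmul_apply, smul_eq_mul]

theorem integrable_mul_normed_sub (hu : LocallyIntegrable u) (x : E) :
    Integrable fun t => u t * φ.normed volume (x - t) := by
  simpa only [ConvolutionExistsAt, lsmul_apply, smul_eq_mul] using
    (φ.hasCompactSupport_normed (μ := volume)).convolutionExists_right (lsmul ℝ ℝ) hu
      φ.continuous_normed x

theorem contDiff_mollify (hu : LocallyIntegrable u) (n : ℕ∞) : ContDiff ℝ n (mollify φ u) :=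
  φ.hasCompactSupport_normed.contDiff_convolution_right (lsmul ℝ ℝ) hu φ.contDiff_normed

theorem support_mollify_subset (u : E → ℝ) :
    Function.support (mollify φ u) ⊆ Metric.cthickening φ.rOut (tsupport u) := by
  refine (support_convolution_subset_swap (L := lsmul ℝ ℝ)).trans ?_
  rw [φ.support_normed_eq]
  rintro _ ⟨y, hy, z, hz, rfl⟩
  refine Metric.mem_cthickening_of_dist_le _ z _ _ (subset_tsupport _ hz) ?_
  simpa using (mem_ball_zero_iff.1 hy).le

theorem hasCompactSupport_mollify (hc : HasCompactSupport u) :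
    HasCompactSupport (mollify φ u) :=
  hc.convolution (lsmul ℝ ℝ) φ.hasCompactSupport_normed

theorem mollify_sub (hu : LocallyIntegrable u) (hv : LocallyIntegrable v) :
    mollify φ (u - v) = mollify φ u - mollify φ v := by
  funext x
  simp only [Pi.sub_apply, mollify_apply, sub_mul]
  exact integral_sub (integrable_mul_normed_sub φ hu x) (integrable_mul_normed_sub φ hv x)

theorem integrable_mollify (hu : Integrable u) : Integrable (mollify φ u) :=
  hu.integrable_convolution (lsmul ℝ ℝ) φ.integrable_normed

theorem integral_mollify (hu : Integrable u) : ∫ x, mollify φ u x = ∫ x, u x := by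
  rw [mollify, integral_convolution _ hu φ.integrable_normed, φ.integral_normed]
  simp

theorem mollify_sq_le (hu : MemLp u 2) (x : E) :
    mollify φ u x ^ 2 ≤ mollify φ (fun y => u y ^ 2) x := by
  have i₀ : Integrable fun t => φ.normed volume (x - t) := φ.integrable_normed.comp_sub_left x
  have i₁ := integrable_mul_normed_sub φ (hu.locallyIntegrable one_le_two) x
  have i₂ := integrable_mul_normed_sub φ hu.integrable_sq.locallyIntegrable x
  have hone : ∫ t, φ.normed volume (x - t) = 1 :=
    (integral_sub_left_eq_self _ volume x).trans φ.integral_normed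
  set m := mollify φ u x with hm
  have hvariance : 0 ≤ ∫ t, (u t - m) ^ 2 * φ.normed volume (x - t) :=
    integral_nonneg fun t => mul_nonneg (sq_nonneg _) (φ.nonneg_normed _)
  have hexpand (t) : (u t - m) ^ 2 * φ.normed volume (x - t) = u t ^ 2 * φ.normed volume (x - t)
      - 2 * m * (u t * φ.normed volume (x - t)) + m ^ 2 * φ.normed volume (x - t) := by ring
  simp only [hexpand] at hvariance
  rw [integral_add (by fun_prop) (by fun_prop), integral_sub i₂ (i₁.const_mul _),
    integral_const_mul, integral_const_mul, hone, ← mollify_apply, ← mollify_apply, ← hm]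
    at hvariance
  linarith

theorem memLp_mollify (hu : MemLp u 2) : MemLp (mollify φ u) 2 := by
  have hm : AEStronglyMeasurable (mollify φ u) volume :=
    (contDiff_mollify φ (hu.locallyIntegrable one_le_two) 0).continuous.aestronglyMeasurable
  refine (memLp_two_iff_integrable_sq hm).2 <|
    (integrable_mollify φ hu.integrable_sq).mono' (hm.pow 2) (Eventually.of_forall fun x => ?_)
  rw [Real.norm_of_nonneg (sq_nonneg _)]
  exact mollify_sq_le φ hu x

theorem eLpNorm_mollify_le (hu : MemLp u 2) : eLpNorm (mollify φ u) 2 ≤ eLpNorm u 2 := by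
  have hint : ∫ x, mollify φ u x ^ 2 ≤ ∫ x, u x ^ 2 := by
    rw [← integral_mollify φ hu.integrable_sq]
    exact integral_mono (memLp_mollify φ hu).integrable_sq
      (integrable_mollify φ hu.integrable_sq) (mollify_sq_le φ hu)
  rw [(memLp_mollify φ hu).eLpNorm_eq_integral_rpow_norm two_ne_zero ENNReal.ofNat_ne_top,
    hu.eLpNorm_eq_integral_rpow_norm two_ne_zero ENNReal.ofNat_ne_top]
  simp only [ENNReal.toReal_ofNat, Real.rpow_two, Real.norm_eq_abs, sq_abs]
  gcongr

theorem dist_mollify_le_of_continuous {ε : ℝ} (hu : Continuous u) {x : E}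
    (h : ∀ y ∈ Metric.ball x φ.rOut, dist (u y) (u x) ≤ ε) : dist (mollify φ u x) (u x) ≤ ε := by
  have hswap : mollify φ u x = (φ.normed volume ⋆[lsmul ℝ ℝ, volume] u) x := by
    rw [mollify, convolution_eq_swap, convolution_def]
    simp only [lsmul_apply, smul_eq_mul, mul_comm]
  rw [hswap]
  exact φ.dist_normed_convolution_le hu.aestronglyMeasurable h

variable {β : Type*} {l : Filter β} {Φ : β → ContDiffBump (0 : E)}

theorem tendsto_eLpNorm_mollify_sub_of_continuous (hΦ : Tendsto (fun k => (Φ k).rOut) l (𝓝 0))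
    (hu : Continuous u) (hc : HasCompactSupport u) :
    Tendsto (fun k => eLpNorm (mollify (Φ k) u - u) 2) l (𝓝 0) := by
  have hS : IsCompact (Metric.cthickening 1 (tsupport u)) := hc.cthickening
  refine ENNReal.tendsto_nhds_zero.2 fun ε hε => ?_
  obtain ⟨ε', hε', hlt⟩ := ENNReal.exists_nnreal_pos_mul_lt
    (ENNReal.rpow_ne_top_of_nonneg (y := 1 / (2 : ℝ≥0∞).toReal) (by positivity)
      (hS.measure_lt_top (μ := volume)).ne) hε.ne'
  obtain ⟨r, hr, hunif⟩ :=
    Metric.uniformContinuous_iff.1 (hc.uniformContinuous_of_continuous hu) ε' hε'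
  filter_upwards [hΦ.eventually (gt_mem_nhds hr), hΦ.eventually (gt_mem_nhds one_pos)]
    with k hkr hk1
  refine le_trans ?_ hlt.le
  rw [← ENNReal.ofReal_coe_nnreal]
  refine eLpNorm_sub_le_of_dist_bdd volume ENNReal.ofNat_ne_top hS.measurableSet ε'.2
    (fun x => dist_mollify_le_of_continuous (Φ k) hu fun y hy => ?_)
    ((support_mollify_subset (Φ k) u).trans (Metric.cthickening_mono hk1.le _))
    ((subset_tsupport u).trans (Metric.self_subset_cthickening _))
  exact (hunif ((Metric.mem_ball.1 hy).trans hkr)).le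

theorem eLpNorm_mollify_sub_le (hu : MemLp u 2) (hv : MemLp v 2) :
    eLpNorm (mollify φ u - u) 2
      ≤ eLpNorm (mollify φ v - v) 2 + (eLpNorm (u - v) 2 + eLpNorm (u - v) 2) := by
  have hsplit : mollify φ u - u = (mollify φ v - v) + (mollify φ (u - v) - (u - v)) := by
    rw [mollify_sub φ (hu.locallyIntegrable one_le_two) (hv.locallyIntegrable one_le_two)]
    abel
  have huv := hu.sub hv
  have hm := memLp_mollify φ huv
  rw [hsplit]
  refine (eLpNorm_add_le ((memLp_mollify φ hv).sub hv).aestronglyMeasurable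
    (hm.sub huv).aestronglyMeasurable one_le_two).trans (add_le_add_right ?_ _)
  exact (eLpNorm_sub_le hm.aestronglyMeasurable huv.aestronglyMeasurable one_le_two).trans
    (add_le_add_left (eLpNorm_mollify_le φ huv) _)

theorem tendsto_eLpNorm_mollify_sub (hΦ : Tendsto (fun k => (Φ k).rOut) l (𝓝 0))
    (hu : MemLp u 2) : Tendsto (fun k => eLpNorm (mollify (Φ k) u - u) 2) l (𝓝 0) := by
  refine ENNReal.tendsto_nhds_zero.2 fun ε hε => ?_
  have hε3 : 0 < ε / 3 := ENNReal.div_pos hε.ne' ENNReal.ofNat_ne_top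
  obtain ⟨c, hcc, huc, hc, hcm⟩ :=
    hu.exists_hasCompactSupport_eLpNorm_sub_le ENNReal.ofNat_ne_top hε3.ne'
  have hlim := tendsto_eLpNorm_mollify_sub_of_continuous hΦ hc hcc
  filter_upwards [ENNReal.tendsto_nhds_zero.1 hlim (ε / 3) hε3] with k hk
  rw [← ENNReal.add_thirds ε, add_assoc]
  exact (eLpNorm_mollify_sub_le (Φ k) hu hcm).trans (add_le_add hk (add_le_add huc huc))

end Mollification

section WeakSolutions

variable {E : Type*} [NormedAddCommGroup E] [InnerProductSpace ℝ E] [FiniteDimensional ℝ E]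
  [MeasurableSpace E] [BorelSpace E] {Ω S : Set E} {ρ : ℝ} {W u f : E → ℝ}

/-- `u` solves `Δu = W u` in the sense of distributions on `Ω`. -/
def IsWeakSolution (Ω : Set E) (W u : E → ℝ) : Prop :=
  ∀ θ : E → ℝ, ContDiff ℝ (⊤ : ℕ∞) θ → HasCompactSupport θ → tsupport θ ⊆ Ω →
    ∫ x, u x * Laplacian.laplacian θ x = ∫ x, u x * (W x * θ x)

theorem IsWeakSolution.laplacian_mollify (h : IsWeakSolution Ω W u) (hu : LocallyIntegrable u)
    (hSΩ : S ⊆ Ω) (φ : ContDiffBump (0 : E)) {x : E} (hx : Metric.closedBall x φ.rOut ⊆ S) :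
    Laplacian.laplacian (mollify φ u) x = mollify φ (S.indicator fun y => u y * W y) x := by
  let θ : E → ℝ := fun y => φ.normed volume (x - y)
  have hsmooth (n : ℕ∞) : ContDiff ℝ n (φ.normed (volume : Measure E)) := φ.contDiff_normed
  have hts : tsupport θ ⊆ Metric.closedBall x φ.rOut := by
    refine closure_minimal (fun y hy => ?_) Metric.isClosed_closedBall
    have hball : x - y ∈ Metric.ball (0 : E) φ.rOut := by
      rw [← φ.support_normed_eq (μ := volume)]
      exact hy
    rw [Metric.mem_closedBall, dist_comm, dist_eq_norm]
    exact (mem_ball_zero_iff.1 hball).le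
  have hθc : HasCompactSupport θ :=
    (isCompact_closedBall x φ.rOut).of_isClosed_subset (isClosed_tsupport _) hts
  have htest := h θ ((hsmooth ⊤).comp (contDiff_const.sub contDiff_id)) hθc
    (hts.trans (hx.trans hSΩ))
  simp only [θ, laplacian_comp_const_sub (hsmooth 2)] at htest
  rw [mollify, laplacian_convolution_right hu (hsmooth 2) φ.hasCompactSupport_normed, htest,
    mollify_apply]
  refine integral_congr_ae (Eventually.of_forall fun y => ?_)
  change u y * (W y * θ y) = S.indicator (fun y => u y * W y) y * θ y
  by_cases hy : y ∈ S
  · rw [indicator_of_mem hy, mul_assoc]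
  · simp only [image_eq_zero_of_notMem_tsupport fun hy' => hy (hx (hts hy')), mul_zero]

theorem memLp_top_hardyPotential_mul_sq (hΩ : IsOpen Ω) (hne : Ω ≠ univ)
    (hf : IsCompactLipschitz f) (hsupp : tsupport f ⊆ Ω) :
    MemLp (fun x => hardyPotential Ω ρ x * (f x * f x)) ∞ := by
  have hc : HasCompactSupport fun x => hardyPotential Ω ρ x * (f x * f x) :=
    (hf.mul hf).hasCompactSupport.mul_left
  refine Continuous.memLp_top_of_hasCompactSupport ?_ hc _
  refine ((continuousOn_hardyPotential hΩ hne).mul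
    (hf.mul hf).continuous.continuousOn).continuous_of_tsupport_subset hΩ ?_
  exact (tsupport_mul_subset_right.trans tsupport_mul_subset_left).trans hsupp

theorem memLp_top_norm_gradient_sq (hf : IsCompactLipschitz f) :
    MemLp (fun x => ‖gradient f x‖ ^ 2) ∞ := by
  obtain ⟨C, hC⟩ := hf.exists_lipschitzWith
  refine memLp_top_of_bound ((measurable_gradient f).norm.pow_const 2).aestronglyMeasurable
    (C ^ 2 : ℝ) (Eventually.of_forall fun x => ?_)
  rw [norm_pow, norm_norm]
  exact pow_le_pow_left₀ (norm_nonneg _) (norm_gradient_le_of_lipschitzWith hC x) 2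

theorem integrable_norm_gradient_sq_mul_sq (hf : IsCompactLipschitz f) (hu : MemLp u 2) :
    Integrable fun x => ‖gradient f x‖ ^ 2 * u x ^ 2 := by
  simpa only [sq (u _)] using integrable_mul_mul_of_memLp (memLp_top_norm_gradient_sq hf) hu hu

theorem IsWeakSolution.integral_mollify_le (hΩ : IsOpen Ω) (hne : Ω ≠ univ)
    (hball : HasExteriorBalls Ω ρ) (h : IsWeakSolution Ω W u) (hu : LocallyIntegrable u)
    (huc : HasCompactSupport u) (hf : IsCompactLipschitz f) (hSΩ : S ⊆ Ω)
    (φ : ContDiffBump (0 : E)) (hφ : Metric.cthickening φ.rOut (tsupport f) ⊆ S) :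
    (∫ x, hardyPotential Ω ρ x * (f x * f x) * (mollify φ u x * mollify φ u x))
        + ∫ x, f x * f x * (mollify φ u x * mollify φ (S.indicator fun y => u y * W y) x)
      ≤ ∫ x, ‖gradient f x‖ ^ 2 * (mollify φ u x * mollify φ u x) := by
  have hsupp : tsupport f ⊆ Ω := ((Metric.self_subset_cthickening _).trans hφ).trans hSΩ
  have henergy := integral_hardyPotential_mul_sq_add_le hΩ hne hball (contDiff_mollify φ hu 2)
    (hasCompactSupport_mollify φ huc) hf hsupp
  have hlaplacian (x) : f x * f x * mollify φ u x * Laplacian.laplacian (mollify φ u) x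
      = f x * f x * (mollify φ u x * mollify φ (S.indicator fun y => u y * W y) x) := by
    by_cases hx : x ∈ tsupport f
    · rw [h.laplacian_mollify hu hSΩ φ
        ((Metric.closedBall_subset_cthickening hx _).trans hφ), mul_assoc]
    · simp only [image_eq_zero_of_notMem_tsupport hx, zero_mul]
  simp only [hlaplacian, mul_pow, sq (f _), sq (mollify φ u _), ← mul_assoc] at henergy ⊢
  exact henergy

/-- The energy inequality for the mollifications of `u` passes to the limit, since the weights
`hardyPotential Ω ρ * f ^ 2`, `f ^ 2` and `‖∇f‖ ^ 2` are bounded. -/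
theorem IsWeakSolution.integral_le (hΩ : IsOpen Ω) (hne : Ω ≠ univ)
    (hball : HasExteriorBalls Ω ρ) (h : IsWeakSolution Ω W u) (hu : MemLp u 2)
    (huc : HasCompactSupport u) (hf : IsCompactLipschitz f) {r : ℝ} (hr : 0 < r)
    (hrΩ : Metric.cthickening r (tsupport f) ⊆ Ω)
    (hw : MemLp ((Metric.cthickening r (tsupport f)).indicator fun x => u x * W x) 2) :
    (∫ x, hardyPotential Ω ρ x * (f x * f x) * (u x * u x))
        + ∫ x, f x * f x * (u x
            * (Metric.cthickening r (tsupport f)).indicator (fun y => u y * W y) x)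
      ≤ ∫ x, ‖gradient f x‖ ^ 2 * (u x * u x) := by
  let Φ : ℕ → ContDiffBump (0 : E) := fun k =>
    ⟨1 / ((k : ℝ) + 1) / 2, 1 / ((k : ℝ) + 1), by positivity, half_lt_self (by positivity)⟩
  have hΦ : Tendsto (fun k => (Φ k).rOut) atTop (𝓝 0) := tendsto_one_div_add_atTop_nhds_zero_nat
  have hU := fun k => memLp_mollify (Φ k) hu
  have hUu := tendsto_eLpNorm_mollify_sub hΦ hu
  have hsupp : tsupport f ⊆ Ω := (Metric.self_subset_cthickening _).trans hrΩ
  have hff : MemLp (fun x => f x * f x) ∞ :=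
    (hf.mul hf).continuous.memLp_top_of_hasCompactSupport (hf.mul hf).hasCompactSupport _
  refine le_of_tendsto_of_tendsto
    ((tendsto_integral_mul_mul (memLp_top_hardyPotential_mul_sq hΩ hne hf hsupp)
      hU hu hU hu hUu hUu).add
    (tendsto_integral_mul_mul hff hU hu (fun k => memLp_mollify (Φ k) hw) hw hUu
      (tendsto_eLpNorm_mollify_sub hΦ hw)))
    (tendsto_integral_mul_mul (memLp_top_norm_gradient_sq hf) hU hu hU hu hUu hUu) ?_
  filter_upwards [hΦ.eventually (gt_mem_nhds hr)] with k hk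
  exact h.integral_mollify_le hΩ hne hball (hu.locallyIntegrable one_le_two) huc hf hrΩ (Φ k)
    (Metric.cthickening_mono hk.le _)

theorem IsWeakSolution.energy_inequality (hΩ : IsOpen Ω) (hne : Ω ≠ univ)
    (hball : HasExteriorBalls Ω ρ) (h : IsWeakSolution Ω W u) (hu : MemLp u 2)
    (huc : HasCompactSupport u)
    (hW : ∀ K : Set E, IsCompact K → K ⊆ Ω → MemLp W ∞ (volume.restrict K))
    (hf : IsCompactLipschitz f) (hsupp : tsupport f ⊆ Ω) :
    Integrable (fun x => (hardyPotential Ω ρ x + W x) * (f x * u x) ^ 2) ∧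
      ∫ x, (hardyPotential Ω ρ x + W x) * (f x * u x) ^ 2
        ≤ ∫ x, ‖gradient f x‖ ^ 2 * u x ^ 2 := by
  obtain ⟨r, hr, hrΩ⟩ := hf.hasCompactSupport.exists_cthickening_subset_open hΩ hsupp
  set S := Metric.cthickening r (tsupport f)
  have hSc : IsCompact S := IsCompact.cthickening hf.hasCompactSupport
  have hw : MemLp (S.indicator fun x => u x * W x) 2 := by
    rw [memLp_indicator_iff_restrict hSc.measurableSet]
    exact (hW S hSc hrΩ).mul (hu.restrict S)
  have hff : MemLp (fun x => f x * f x) ∞ :=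
    (hf.mul hf).continuous.memLp_top_of_hasCompactSupport (hf.mul hf).hasCompactSupport _
  have hpotential :=
    integrable_mul_mul_of_memLp (memLp_top_hardyPotential_mul_sq (ρ := ρ) hΩ hne hf hsupp) hu hu
  have hcross := integrable_mul_mul_of_memLp hff hu hw
  have hsum (x) : hardyPotential Ω ρ x * (f x * f x) * (u x * u x)
      + f x * f x * (u x * S.indicator (fun y => u y * W y) x)
      = (hardyPotential Ω ρ x + W x) * (f x * u x) ^ 2 := by
    by_cases hx : x ∈ tsupport f
    · rw [indicator_of_mem (Metric.self_subset_cthickening _ hx)]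
      ring
    · simp only [image_eq_zero_of_notMem_tsupport hx]
      ring
  have hle := h.integral_le hΩ hne hball hu huc hf hr hrΩ hw
  rw [← integral_add hpotential hcross, integral_congr_ae (Eventually.of_forall hsum)] at hle
  simp only [← sq (u _)] at hle
  exact ⟨(hpotential.add hcross).congr (Eventually.of_forall hsum), hle⟩

end WeakSolutions

section AgmonWeight

theorem deriv_smoothTransition_eq_zero {y : ℝ} (hy : y ∉ Ioo 0 1) :
    deriv Real.smoothTransition y = 0 := by
  rcases le_or_gt y 0 with hy0 | hy0
  · refine IsLocalMin.deriv_eq_zero (Eventually.of_forall fun z => ?_)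
    rw [Real.smoothTransition.zero_of_nonpos hy0]
    exact Real.smoothTransition.nonneg z
  · refine IsLocalMax.deriv_eq_zero (Eventually.of_forall fun z => ?_)
    rw [Real.smoothTransition.one_of_one_le (not_lt.1 fun hy1 => hy ⟨hy0, hy1⟩)]
    exact Real.smoothTransition.le_one z

/-- A smooth cutoff which vanishes for `t ≤ s / 2` and equals `1` for `s ≤ t`. -/
noncomputable def shellCutoff (s t : ℝ) : ℝ := Real.smoothTransition (2 / s * t - 1)

theorem shellCutoff_nonneg (s t : ℝ) : 0 ≤ shellCutoff s t := Real.smoothTransition.nonneg _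

theorem shellCutoff_le_one (s t : ℝ) : shellCutoff s t ≤ 1 := Real.smoothTransition.le_one _

theorem contDiff_shellCutoff (s : ℝ) : ContDiff ℝ 1 (shellCutoff s) :=
  Real.smoothTransition.contDiff.comp (by fun_prop)

variable {G : ℝ → ℝ} {s t c ρ₀ : ℝ}

theorem shellCutoff_eq_zero (hs : 0 < s) (ht : t ≤ s / 2) : shellCutoff s t = 0 := by
  refine Real.smoothTransition.zero_of_nonpos ?_
  rw [div_mul_eq_mul_div, sub_nonpos, div_le_one hs]
  linarith

theorem shellCutoff_eq_one (hs : 0 < s) (ht : s ≤ t) : shellCutoff s t = 1 := by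
  refine Real.smoothTransition.one_of_one_le ?_
  rw [div_mul_eq_mul_div, le_sub_iff_add_le, le_div_iff₀ hs]
  linarith

theorem deriv_shellCutoff (s t : ℝ) :
    deriv (shellCutoff s) t = 2 / s * deriv Real.smoothTransition (2 / s * t - 1) := by
  have haffine : HasDerivAt (fun t => 2 / s * t - 1) (2 / s) t := by
    simpa using ((hasDerivAt_id' t).const_mul (2 / s)).sub_const 1
  have hsmooth : DifferentiableAt ℝ Real.smoothTransition (2 / s * t - 1) :=
    (Real.smoothTransition.contDiff (n := 1)).differentiable one_ne_zero _
  exact (hsmooth.hasDerivAt.comp t haffine).deriv.trans (mul_comm _ _)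

theorem deriv_shellCutoff_eq_zero (hs : 0 < s) (ht : t ∉ Ioo (s / 2) s) :
    deriv (shellCutoff s) t = 0 := by
  rw [deriv_shellCutoff, deriv_smoothTransition_eq_zero, mul_zero]
  refine fun h => ht ⟨?_, ?_⟩
  · have h0 := h.1
    rw [div_mul_eq_mul_div, sub_pos, one_lt_div hs] at h0
    linarith
  · have h1 := h.2
    rw [div_mul_eq_mul_div, sub_lt_iff_lt_add, div_lt_iff₀ hs] at h1
    linarith

theorem exists_abs_deriv_shellCutoff_le :
    ∃ c > 0, ∀ s > 0, ∀ t, |deriv (shellCutoff s) t| ≤ c / s := by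
  have hcont : Continuous (deriv Real.smoothTransition) :=
    (Real.smoothTransition.contDiff (n := 1)).continuous_deriv le_rfl
  have hcompact : HasCompactSupport (deriv Real.smoothTransition) :=
    .intro isCompact_Icc fun y hy =>
      deriv_smoothTransition_eq_zero fun hy' => hy (Ioo_subset_Icc_self hy')
  obtain ⟨c, hc⟩ := hcompact.exists_bound_of_continuous hcont
  refine ⟨2 * (|c| + 1), by positivity, fun s hs t => ?_⟩
  rw [deriv_shellCutoff, abs_mul, abs_of_pos (by positivity : 0 < 2 / s), mul_div_right_comm]
  gcongr
  exact (hc _).trans (by linarith [le_abs_self c])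

/-- The Agmon weight `exp (G t)`, cut off on the shell `[s / 2, s]`. -/
noncomputable def agmonWeight (G : ℝ → ℝ) (s t : ℝ) : ℝ := shellCutoff s t * Real.exp (G t)

theorem agmonWeight_eq_exp (hs : 0 < s) (ht : s ≤ t) : agmonWeight G s t = Real.exp (G t) := by
  rw [agmonWeight, shellCutoff_eq_one hs ht, one_mul]

theorem hasDerivAt_agmonWeight (hG : DifferentiableAt ℝ G t) (s : ℝ) :
    HasDerivAt (agmonWeight G s)
      (Real.exp (G t) * (deriv G t * shellCutoff s t + deriv (shellCutoff s) t)) t := by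
  have hcutoff := ((contDiff_shellCutoff s).differentiable one_ne_zero t).hasDerivAt
  refine (hcutoff.mul hG.hasDerivAt.exp).congr_deriv ?_
  ring

theorem deriv_agmonWeight_sq_le (hG : DifferentiableAt ℝ G t)
    (hG' : deriv G t ∈ Icc 0 (1 / t)) (hGs : t ≤ s → G t ≤ G s) (hs : 0 < s)
    (hc : |deriv (shellCutoff s) t| ≤ c / s) :
    deriv (agmonWeight G s) t ^ 2 ≤ deriv G t ^ 2 * agmonWeight G s t ^ 2
      + (Ico (s / 2) s).indicator (fun _ => Real.exp (2 * G s) * ((4 * c + c ^ 2) / s ^ 2)) t := by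
  have hexp (r : ℝ) : Real.exp (2 * r) = Real.exp r ^ 2 := by rw [← Real.exp_nat_mul]; norm_num
  have hexpand : deriv (agmonWeight G s) t ^ 2 = deriv G t ^ 2 * agmonWeight G s t ^ 2
      + Real.exp (2 * G t) * (2 * (deriv G t * shellCutoff s t) * deriv (shellCutoff s) t
        + deriv (shellCutoff s) t ^ 2) := by
    rw [(hasDerivAt_agmonWeight hG s).deriv, agmonWeight, hexp]
    ring
  rw [hexpand]
  gcongr
  by_cases ht : t ∈ Ico (s / 2) s
  · have hcs : 0 ≤ c / s := (abs_nonneg _).trans hc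
    have hle : deriv G t ≤ 2 / s :=
      hG'.2.trans ((one_div_le_one_div_of_le (half_pos hs) ht.1).trans_eq (one_div_div s 2))
    have hχ : |deriv G t * shellCutoff s t| ≤ 2 / s := by
      rw [abs_of_nonneg (mul_nonneg hG'.1 (shellCutoff_nonneg s t))]
      exact (mul_le_of_le_one_right hG'.1 (shellCutoff_le_one s t)).trans hle
    have herror : 2 * (deriv G t * shellCutoff s t) * deriv (shellCutoff s) t
        + deriv (shellCutoff s) t ^ 2 ≤ 2 * (2 / s) * (c / s) + (c / s) ^ 2 := by
      calc _ ≤ 2 * |deriv G t * shellCutoff s t| * |deriv (shellCutoff s) t|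
            + |deriv (shellCutoff s) t| ^ 2 := by
            have hcross := le_abs_self (deriv G t * shellCutoff s t * deriv (shellCutoff s) t)
            rw [abs_mul] at hcross
            rw [sq_abs]
            linarith
        _ ≤ _ := by gcongr
    rw [indicator_of_mem ht,
      show (4 * c + c ^ 2) / s ^ 2 = 2 * (2 / s) * (c / s) + (c / s) ^ 2 by ring]
    refine mul_le_mul_of_nonneg ?_ herror (Real.exp_pos _).le (by positivity)
    exact Real.exp_le_exp.2 (by linarith [hGs ht.2.le])
  · rw [indicator_of_notMem ht,
      deriv_shellCutoff_eq_zero hs fun ht' => ht (Ioo_subset_Ico_self ht')]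
    simp

/-- Off the shell the weight solves the eikonal equation `f' = G' f`; on the shell the bound
`G' t ≤ 1 / t ≤ 2 / s` makes the error quadratic in `1 / s`. -/
theorem indicator_add_deriv_agmonWeight_sq_le (hG : ContDiffOn ℝ 1 G (Ioi 0))
    (hG' : ∀ t, 0 < t → deriv G t ∈ Icc 0 (1 / t)) (hs : 0 < s) (hsρ : s ≤ ρ₀)
    (hc : ∀ t, |deriv (shellCutoff s) t| ≤ c / s) (ht : 0 < t) :
    (Ici ρ₀).indicator (fun _ => Real.exp (2 * G ρ₀)) t + deriv (agmonWeight G s) t ^ 2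
      ≤ (deriv G t ^ 2 + 1) * agmonWeight G s t ^ 2
        + (Ico (s / 2) s).indicator
          (fun _ => Real.exp (2 * G s) * ((4 * c + c ^ 2) / s ^ 2)) t := by
  have hd (r : ℝ) (hr : 0 < r) : DifferentiableAt ℝ G r :=
    (hG.contDiffAt (Ioi_mem_nhds hr)).differentiableAt one_ne_zero
  have hmono : MonotoneOn G (Ioi 0) :=
    monotoneOn_of_deriv_nonneg (convex_Ioi 0) hG.continuousOn
      (fun r hr => (hd r (interior_subset hr)).differentiableWithinAt)
      fun r hr => (hG' r (interior_subset hr)).1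
  have hweight : (Ici ρ₀).indicator (fun _ => Real.exp (2 * G ρ₀)) t ≤ agmonWeight G s t ^ 2 := by
    by_cases hρt : ρ₀ ≤ t
    · rw [indicator_of_mem (mem_Ici.2 hρt), agmonWeight_eq_exp hs (hsρ.trans hρt),
        ← Real.exp_nat_mul, Nat.cast_ofNat]
      gcongr
      exact hmono (hs.trans_le hsρ) ht hρt
    · rw [indicator_of_notMem (notMem_Ici.2 (not_le.1 hρt))]
      exact sq_nonneg _
  linarith [deriv_agmonWeight_sq_le (hd t ht) (hG' t ht) (hmono ht hs) hs (hc t)]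

end AgmonWeight

section Decay

theorem indicator_const_comp_mul_eq {X Y : Type*} (δ : X → Y) (T : Set Y) (c : ℝ) (w : X → ℝ) :
    (fun x => T.indicator (fun _ => c) (δ x) * w x) = (δ ⁻¹' T).indicator fun x => c * w x := by
  classical
  ext x
  simp only [indicator_apply, mem_preimage, ite_mul, zero_mul]

theorem integrable_indicator_const_comp_mul {X Y : Type*} [MeasurableSpace X] [MeasurableSpace Y]
    {μ : Measure X} {δ : X → Y} {T : Set Y} {w : X → ℝ} (hδ : Measurable δ) (hT : MeasurableSet T)
    (hw : Integrable w μ) (c : ℝ) :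
    Integrable (fun x => T.indicator (fun _ => c) (δ x) * w x) μ := by
  rw [indicator_const_comp_mul_eq]
  exact (hw.const_mul c).indicator (hδ hT)

theorem integral_indicator_const_comp_mul {X Y : Type*} [MeasurableSpace X] [MeasurableSpace Y]
    {μ : Measure X} {δ : X → Y} {T : Set Y} (hδ : Measurable δ) (hT : MeasurableSet T) (c : ℝ)
    (w : X → ℝ) :
    ∫ x, T.indicator (fun _ => c) (δ x) * w x ∂μ = c * ∫ x in δ ⁻¹' T, w x ∂μ := by
  rw [indicator_const_comp_mul_eq, integral_indicator (hδ hT), integral_const_mul]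

theorem tsupport_shellCutoff_comp_subset {X : Type*} [TopologicalSpace X] {δ : X → ℝ} {s : ℝ}
    (hδ : Continuous δ) (hs : 0 < s) :
    (tsupport fun x => shellCutoff s (δ x)) ⊆ {x | s / 2 ≤ δ x} := by
  refine closure_minimal (fun x hx => ?_) (isClosed_le continuous_const hδ)
  exact le_of_not_ge fun hle => hx (shellCutoff_eq_zero hs hle)

theorem isCompactLipschitz_shellCutoff_infDist_compl {E : Type*} [PseudoMetricSpace E]
    [ProperSpace E] {Ω : Set E} {s : ℝ} (hbdd : Bornology.IsBounded Ω) (hs : 0 < s) :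
    IsCompactLipschitz fun x => shellCutoff s (Metric.infDist x Ωᶜ) := by
  obtain ⟨c, hc0, hc⟩ := exists_abs_deriv_shellCutoff_le
  have hlip : LipschitzWith (c / s).toNNReal (shellCutoff s) := by
    refine lipschitzWith_of_nnnorm_deriv_le ((contDiff_shellCutoff s).differentiable one_ne_zero)
      fun t => NNReal.coe_le_coe.1 ?_
    rw [coe_nnnorm, Real.coe_toNNReal _ (by positivity)]
    exact hc s hs t
  have hδ : LipschitzWith 1 fun x => Metric.infDist x Ωᶜ := Metric.lipschitz_infDist_pt _
  exact ⟨⟨_, hlip.comp hδ⟩, (isCompact_setOf_le_infDist_compl hbdd (half_pos hs)).of_isClosed_subset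
    (isClosed_tsupport _) (tsupport_shellCutoff_comp_subset hδ.continuous hs)⟩

theorem isCompactLipschitz_agmonWeight_infDist_compl {E : Type*} [PseudoMetricSpace E]
    [ProperSpace E] {Ω : Set E} {G : ℝ → ℝ} {s : ℝ} (hbdd : Bornology.IsBounded Ω) (hs : 0 < s)
    (hG : ContDiffOn ℝ 1 G (Ioi 0)) :
    IsCompactLipschitz fun x => agmonWeight G s (Metric.infDist x Ωᶜ) := by
  have hδ : LipschitzWith 1 fun x => Metric.infDist x Ωᶜ := Metric.lipschitz_infDist_pt _
  exact (isCompactLipschitz_shellCutoff_infDist_compl hbdd hs).mul_comp_of_contDiffOn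
    (h := fun t => Real.exp (G t)) hδ hG.exp ordConnected_Ioi fun x hx =>
      (half_pos hs).trans_le (tsupport_shellCutoff_comp_subset hδ.continuous hs hx)

theorem tsupport_agmonWeight_infDist_compl_subset {E : Type*} [PseudoMetricSpace E] {Ω : Set E}
    {G : ℝ → ℝ} {s : ℝ} (hs : 0 < s) :
    (tsupport fun x => agmonWeight G s (Metric.infDist x Ωᶜ)) ⊆ Ω := fun x hx => by
  by_contra hxΩ
  have hx0 : Metric.infDist x Ωᶜ = 0 := Metric.infDist_zero_of_mem hxΩ
  have hle : s / 2 ≤ Metric.infDist x Ωᶜ :=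
    tsupport_shellCutoff_comp_subset (Metric.continuous_infDist_pt _) hs
      (tsupport_mul_subset_left hx)
  exact (half_pos hs).not_ge (hx0 ▸ hle)

theorem norm_gradient_comp_le_abs_deriv {E : Type*} [NormedAddCommGroup E] [InnerProductSpace ℝ E]
    [CompleteSpace E] {h : ℝ → ℝ} {δ : E → ℝ} {x : E} (hδ : LipschitzWith 1 δ)
    (hh : DifferentiableAt ℝ h (δ x)) (hd : DifferentiableAt ℝ δ x) :
    ‖gradient (fun y => h (δ y)) x‖ ≤ |deriv h (δ x)| := by
  rw [(hasGradientAt_comp hh.hasDerivAt hd.hasGradientAt).gradient, norm_smul, Real.norm_eq_abs]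
  exact mul_le_of_le_one_right (abs_nonneg _) (norm_gradient_le_of_lipschitzWith hδ x)

theorem indicator_add_norm_gradient_agmonWeight_sq_le {E : Type*} [NormedAddCommGroup E]
    [InnerProductSpace ℝ E] [CompleteSpace E] {δ : E → ℝ} {G : ℝ → ℝ} {c s ρ₀ : ℝ} {x : E}
    (hδ : LipschitzWith 1 δ) (hG : ContDiffOn ℝ 1 G (Ioi 0))
    (hG' : ∀ t, 0 < t → deriv G t ∈ Icc 0 (1 / t)) (hs : 0 < s) (hsρ : s ≤ ρ₀)
    (hc : ∀ t, |deriv (shellCutoff s) t| ≤ c / s) (hx : 0 < δ x) (hd : DifferentiableAt ℝ δ x) :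
    (Ici ρ₀).indicator (fun _ => Real.exp (2 * G ρ₀)) (δ x)
        + ‖gradient (fun y => agmonWeight G s (δ y)) x‖ ^ 2
      ≤ (deriv G (δ x) ^ 2 + 1) * agmonWeight G s (δ x) ^ 2
        + (Ico (s / 2) s).indicator
          (fun _ => Real.exp (2 * G s) * ((4 * c + c ^ 2) / s ^ 2)) (δ x) := by
  refine le_trans ?_ (indicator_add_deriv_agmonWeight_sq_le hG hG' hs hsρ hc hx)
  have hGx := (hG.contDiffAt (Ioi_mem_nhds hx)).differentiableAt one_ne_zero
  rw [← sq_abs (deriv _ _)]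
  gcongr
  exact norm_gradient_comp_le_abs_deriv hδ (hasDerivAt_agmonWeight hGx s).differentiableAt hd

variable {E : Type*} [NormedAddCommGroup E] [InnerProductSpace ℝ E] [FiniteDimensional ℝ E]
  [MeasurableSpace E] [BorelSpace E] {Ω : Set E} {ρ : ℝ} {W u : E → ℝ} {G : ℝ → ℝ}

theorem ae_indicator_add_norm_gradient_agmonWeight_sq_mul_sq_le {c s ρ₀ : ℝ} (hΩ : IsOpen Ω)
    (hne : Ω ≠ univ) (huΩ : ∀ x ∉ Ω, u x = 0) (hG : ContDiffOn ℝ 1 G (Ioi 0))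
    (hG' : ∀ t, 0 < t → deriv G t ∈ Icc 0 (1 / t))
    (hWG : ∀ᵐ x ∂volume.restrict Ω,
      deriv G (Metric.infDist x Ωᶜ) ^ 2 + 1 ≤ hardyPotential Ω ρ x + W x)
    (hs : 0 < s) (hsρ : s ≤ ρ₀) (hc : ∀ t, |deriv (shellCutoff s) t| ≤ c / s) :
    ∀ᵐ x,
      (Ici ρ₀).indicator (fun _ => Real.exp (2 * G ρ₀)) (Metric.infDist x Ωᶜ) * u x ^ 2
          + ‖gradient (fun y => agmonWeight G s (Metric.infDist y Ωᶜ)) x‖ ^ 2 * u x ^ 2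
        ≤ (hardyPotential Ω ρ x + W x) * (agmonWeight G s (Metric.infDist x Ωᶜ) * u x) ^ 2
          + (Ico (s / 2) s).indicator
              (fun _ => Real.exp (2 * G s) * ((4 * c + c ^ 2) / s ^ 2)) (Metric.infDist x Ωᶜ)
            * u x ^ 2 := by
  have hδ : LipschitzWith 1 fun x : E => Metric.infDist x Ωᶜ := Metric.lipschitz_infDist_pt _
  filter_upwards [(ae_restrict_iff' hΩ.measurableSet).1 hWG, hδ.ae_differentiableAt] with x hx hd
  by_cases hxΩ : x ∈ Ω
  · have hweight := indicator_add_norm_gradient_agmonWeight_sq_le hδ hG hG' hs hsρ hc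
      (infDist_compl_pos hΩ hne hxΩ) hd
    have hpotential := mul_le_mul_of_nonneg_right (hx hxΩ)
      (sq_nonneg (agmonWeight G s (Metric.infDist x Ωᶜ)))
    rw [mul_pow, ← mul_assoc, ← add_mul, ← add_mul]
    refine mul_le_mul_of_nonneg_right ?_ (sq_nonneg (u x))
    linarith
  · simp [huΩ x hxΩ]

/-- The Agmon estimate: in the energy inequality with the Agmon weight, the potential absorbs the
eikonal term `G' ^ 2`, and only the error on the shell is left to bound the interior mass. -/
theorem IsWeakSolution.exists_interior_mass_le (hΩ : IsOpen Ω) (hne : Ω ≠ univ)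
    (hbdd : Bornology.IsBounded Ω) (hball : HasExteriorBalls Ω ρ) (h : IsWeakSolution Ω W u)
    (hu : MemLp u 2) (huΩ : ∀ x ∉ Ω, u x = 0)
    (hW : ∀ K : Set E, IsCompact K → K ⊆ Ω → MemLp W ∞ (volume.restrict K))
    (hG : ContDiffOn ℝ 1 G (Ioi 0)) (hG' : ∀ t, 0 < t → deriv G t ∈ Icc 0 (1 / t))
    (hWG : ∀ᵐ x ∂volume.restrict Ω,
      deriv G (Metric.infDist x Ωᶜ) ^ 2 + 1 ≤ hardyPotential Ω ρ x + W x) :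
    ∃ C > 0, ∀ s ρ₀, 0 < s → s ≤ ρ₀ →
      Real.exp (2 * G ρ₀) * ∫ x in (Metric.infDist · Ωᶜ) ⁻¹' Ici ρ₀, u x ^ 2
        ≤ Real.exp (2 * G s) * (C / s ^ 2)
          * ∫ x in (Metric.infDist · Ωᶜ) ⁻¹' Ico (s / 2) s, u x ^ 2 := by
  have huc : HasCompactSupport u :=
    .intro hbdd.isCompact_closure fun x hx => huΩ x fun hxΩ => hx (subset_closure hxΩ)
  obtain ⟨c, hc0, hc⟩ := exists_abs_deriv_shellCutoff_le
  refine ⟨4 * c + c ^ 2, by positivity, fun s ρ₀ hs hsρ => ?_⟩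
  set δ : E → ℝ := (Metric.infDist · Ωᶜ)
  have hδ : LipschitzWith 1 δ := Metric.lipschitz_infDist_pt _
  set f : E → ℝ := fun x => agmonWeight G s (δ x)
  have hf : IsCompactLipschitz f := isCompactLipschitz_agmonWeight_infDist_compl hbdd hs hG
  obtain ⟨hint, henergy⟩ := h.energy_inequality hΩ hne hball hu huc hW hf
    (tsupport_agmonWeight_infDist_compl_subset hs)
  have hpointwise := ae_indicator_add_norm_gradient_agmonWeight_sq_mul_sq_le hΩ hne huΩ hG hG' hWG
    hs hsρ (hc s hs)
  have hu2 : Integrable (fun x => u x ^ 2) := hu.integrable_sq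
  have hleft := integrable_indicator_const_comp_mul hδ.continuous.measurable
    (measurableSet_Ici (a := ρ₀)) hu2 (Real.exp (2 * G ρ₀))
  have hright := integrable_indicator_const_comp_mul hδ.continuous.measurable
    (measurableSet_Ico (a := s / 2) (b := s)) hu2
    (Real.exp (2 * G s) * ((4 * c + c ^ 2) / s ^ 2))
  have hintegral := integral_mono_ae (hleft.add (integrable_norm_gradient_sq_mul_sq hf hu))
    (hint.add hright) hpointwise
  rw [integral_add' hleft (integrable_norm_gradient_sq_mul_sq hf hu), integral_add' hint hright,
    integral_indicator_const_comp_mul hδ.continuous.measurable measurableSet_Ici,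
    integral_indicator_const_comp_mul hδ.continuous.measurable measurableSet_Ico] at hintegral
  linarith

end Decay

section Vanishing

theorem ConditionSigma.deriv_mem_Icc {G : ℝ → ℝ} (hG : ConditionSigma G) {t : ℝ} (ht : 0 < t) :
    deriv G t ∈ Icc 0 (1 / t) := by
  obtain ⟨-, d₀, -, hle, hzero, -⟩ := hG
  rcases lt_or_ge t d₀ with hlt | hge
  · exact hle t ht hlt
  · rw [hzero t hge]
    exact ⟨le_rfl, by positivity⟩

theorem pairwise_disjoint_Ico_half_dyadic {r : ℝ} (hr : 0 ≤ r) :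
    Pairwise (Function.onFun Disjoint fun k : ℕ =>
      Ico (((2 : ℝ) ^ k)⁻¹ * r / 2) (((2 : ℝ) ^ k)⁻¹ * r)) := by
  have hanti : Antitone fun k : ℕ => ((2 : ℝ) ^ k)⁻¹ * r := fun j k hjk => by
    dsimp only
    gcongr
    exact one_le_two
  convert hanti.pairwise_disjoint_on_Ico_succ using 4 with k
  rw [Nat.succ_eq_succ, Nat.succ_eq_add_one, pow_succ, mul_inv]
  ring

theorem sum_setIntegral_le_integral {X ι : Type*} [MeasurableSpace X] {μ : Measure X} {w : X → ℝ}
    {T : ι → Set X} (hw : Integrable w μ) (hw0 : 0 ≤ w) (hT : ∀ k, MeasurableSet (T k))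
    (hdisj : Pairwise (Function.onFun Disjoint T)) (s : Finset ι) :
    ∑ k ∈ s, ∫ x in T k, w x ∂μ ≤ ∫ x, w x ∂μ := by
  rw [← integral_biUnion_finset s (fun k _ => hT k) (hdisj.set_pairwise _)
    fun k _ => hw.integrableOn]
  exact setIntegral_le_integral hw (Eventually.of_forall hw0)

variable {X : Type*} [MeasurableSpace X] {μ : Measure X} {δ w : X → ℝ} {G : ℝ → ℝ} {C : ℝ}

/-- The dyadic shells are disjoint, so a divergent lower bound for their masses is impossible. -/
theorem setIntegral_preimage_Ici_eq_zero_of_le_shell {ρ₀ : ℝ} (hδ : Measurable δ)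
    (hw : Integrable w μ) (hw0 : 0 ≤ w) (hC : 0 < C) (hρ₀ : 0 < ρ₀)
    (hle : ∀ s, 0 < s → s ≤ ρ₀ → Real.exp (2 * G ρ₀) * ∫ x in δ ⁻¹' Ici ρ₀, w x ∂μ
      ≤ Real.exp (2 * G s) * (C / s ^ 2) * ∫ x in δ ⁻¹' Ico (s / 2) s, w x ∂μ)
    (hdiv : Tendsto (fun N => ∑ k ∈ Finset.Icc 1 N,
      ((4 : ℝ) ^ k)⁻¹ * Real.exp (-2 * G (((2 : ℝ) ^ k)⁻¹ * ρ₀))) atTop atTop) :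
    ∫ x in δ ⁻¹' Ici ρ₀, w x ∂μ = 0 := by
  by_contra hne
  set A := ∫ x in δ ⁻¹' Ici ρ₀, w x ∂μ
  have hA : 0 < A := (integral_nonneg hw0).lt_of_ne' hne
  set κ := Real.exp (2 * G ρ₀) * A * ρ₀ ^ 2 / C
  have hκ : 0 < κ := by positivity
  let T (k : ℕ) : Set ℝ := Ico (((2 : ℝ) ^ k)⁻¹ * ρ₀ / 2) (((2 : ℝ) ^ k)⁻¹ * ρ₀)
  have hterm (k : ℕ) : κ * (((4 : ℝ) ^ k)⁻¹ * Real.exp (-2 * G (((2 : ℝ) ^ k)⁻¹ * ρ₀)))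
      ≤ ∫ x in δ ⁻¹' T k, w x ∂μ := by
    have hs : ((2 : ℝ) ^ k)⁻¹ * ρ₀ ≤ ρ₀ :=
      mul_le_of_le_one_left hρ₀.le (inv_le_one_of_one_le₀ (one_le_pow₀ one_le_two))
    have hshell := hle (((2 : ℝ) ^ k)⁻¹ * ρ₀) (by positivity) hs
    have hfour : ((4 : ℝ) ^ k)⁻¹ = (((2 : ℝ) ^ k)⁻¹) ^ 2 := by
      rw [inv_pow, ← pow_mul, mul_comm, pow_mul]
      norm_num
    calc _ = Real.exp (2 * G ρ₀) * A
          / (Real.exp (2 * G (((2 : ℝ) ^ k)⁻¹ * ρ₀)) * (C / (((2 : ℝ) ^ k)⁻¹ * ρ₀) ^ 2)) := by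
          rw [neg_mul, Real.exp_neg, hfour]
          simp only [κ]
          field_simp
      _ ≤ _ := (div_le_iff₀' (by positivity)).2 hshell
  have hsum (N : ℕ) : κ * ∑ k ∈ Finset.Icc 1 N,
      ((4 : ℝ) ^ k)⁻¹ * Real.exp (-2 * G (((2 : ℝ) ^ k)⁻¹ * ρ₀)) ≤ ∫ x, w x ∂μ := by
    rw [Finset.mul_sum]
    refine (Finset.sum_le_sum fun k _ => hterm k).trans
      (sum_setIntegral_le_integral hw hw0 (fun k => hδ measurableSet_Ico) (fun j k hjk => ?_) _)
    exact (pairwise_disjoint_Ico_half_dyadic hρ₀.le hjk).preimage δ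
  obtain ⟨N, hN⟩ := ((hdiv.const_mul_atTop hκ).eventually_gt_atTop (∫ x, w x ∂μ)).exists
  exact hN.not_ge (hsum N)

theorem ae_eq_zero_of_forall_setIntegral_preimage_Ici_eq_zero {r : ℝ} (hδ : Measurable δ)
    (hw : Integrable w μ) (hw0 : 0 ≤ w) (hr : 0 < r)
    (hzero : ∀ s, 0 < s → s ≤ r → ∫ x in δ ⁻¹' Ici s, w x ∂μ = 0) :
    ∀ᵐ x ∂μ, 0 < δ x → w x = 0 := by
  have hlevel (k : ℕ) : ∀ᵐ x ∂μ, r * (1 / ((k : ℝ) + 1)) ≤ δ x → w x = 0 := by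
    have hk := hzero (r * (1 / ((k : ℝ) + 1))) (by positivity)
      (mul_le_of_le_one_right hr.le (div_le_one_of_le₀ (by simp) (by positivity)))
    rw [setIntegral_eq_zero_iff_of_nonneg_ae (Eventually.of_forall hw0) hw.integrableOn] at hk
    exact (ae_restrict_iff' (hδ measurableSet_Ici)).1 hk
  filter_upwards [ae_all_iff.2 hlevel] with x hx hpos
  have hlim : Tendsto (fun k : ℕ => r * (1 / ((k : ℝ) + 1))) atTop (𝓝 0) := by
    simpa using tendsto_one_div_add_atTop_nhds_zero_nat.const_mul r
  obtain ⟨k, hk⟩ := (hlim.eventually_lt_const hpos).exists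
  exact hx k hk.le

theorem IsWeakSolution.ae_eq_zero {E : Type*} [NormedAddCommGroup E] [InnerProductSpace ℝ E]
    [FiniteDimensional ℝ E] [MeasurableSpace E] [BorelSpace E] {Ω : Set E} {ρ : ℝ} {W u : E → ℝ}
    (hΩ : IsOpen Ω) (hne : Ω ≠ univ) (hbdd : Bornology.IsBounded Ω) (hball : HasExteriorBalls Ω ρ)
    (h : IsWeakSolution Ω W u) (hu : MemLp u 2) (huΩ : ∀ x ∉ Ω, u x = 0)
    (hW : ∀ K : Set E, IsCompact K → K ⊆ Ω → MemLp W ∞ (volume.restrict K))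
    (hG : ConditionSigma G)
    (hWG : ∀ᵐ x ∂volume.restrict Ω,
      deriv G (Metric.infDist x Ωᶜ) ^ 2 + 1 ≤ hardyPotential Ω ρ x + W x) :
    u =ᵐ[volume] 0 := by
  obtain ⟨C, hC, hmass⟩ := h.exists_interior_mass_le hΩ hne hbdd hball hu huΩ hW hG.1
    (fun t => hG.deriv_mem_Icc) hWG
  obtain ⟨-, d₀, hd₀, -, -, hdiv⟩ := hG
  have hδ : Measurable fun x => Metric.infDist x Ωᶜ :=
    (Metric.continuous_infDist_pt _).measurable
  have hu2 : Integrable fun x => u x ^ 2 := hu.integrable_sq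
  have hu0 : 0 ≤ fun x => u x ^ 2 := fun x => sq_nonneg (u x)
  filter_upwards [ae_eq_zero_of_forall_setIntegral_preimage_Ici_eq_zero hδ hu2 hu0 (half_pos hd₀)
    fun ρ₀ hρ₀ hle => setIntegral_preimage_Ici_eq_zero_of_le_shell hδ hu2 hu0 hC hρ₀
      (fun s => hmass s ρ₀) (hdiv ρ₀ hρ₀ hle)] with x hx
  by_cases hxΩ : x ∈ Ω
  · exact pow_eq_zero_iff two_ne_zero |>.1 (hx (infDist_compl_pos hΩ hne hxΩ))
  · exact huΩ x hxΩ

end Vanishing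

section Coercivity

variable {E F : Type*} [NormedAddCommGroup E] [InnerProductSpace ℝ E] [FiniteDimensional ℝ E]
  [NormedAddCommGroup F] [NormedSpace ℝ F]

theorem continuous_laplacian {u : E → F} (hu : ContDiff ℝ 2 u) :
    Continuous (Laplacian.laplacian u) := by
  rw [InnerProductSpace.laplacian_eq_iteratedFDeriv_stdOrthonormalBasis]
  exact continuous_finsetSum _ fun i _ =>
    (hu.continuous_iteratedFDeriv (m := 2) le_rfl).eval_const _

theorem hasCompactSupport_laplacian {u : E → F} (hc : HasCompactSupport u) :
    HasCompactSupport (Laplacian.laplacian u) := by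
  refine (hc.iteratedFDeriv (𝕜 := ℝ) 2).mono fun x => mt fun hx => ?_
  simp [InnerProductSpace.laplacian_eq_iteratedFDeriv_stdOrthonormalBasis, hx]

variable [MeasurableSpace E] [BorelSpace E] {Ω : Set E} {ρ : ℝ} {W a : E → ℝ}

theorem integrable_mul_of_forall_memLp_top
    (hW : ∀ K : Set E, IsCompact K → K ⊆ Ω → MemLp W ∞ (volume.restrict K))
    {f : E → ℝ} (hf : Continuous f) (hc : HasCompactSupport f) (hsupp : tsupport f ⊆ Ω) :
    Integrable fun x => W x * f x :=
  have : IsFiniteMeasure (volume.restrict (tsupport f)) :=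
    isFiniteMeasure_restrict.2 hc.measure_ne_top
  integrable_mul_of_integrableOn_tsupport ((hW _ hc hsupp).integrable le_top) hf hc

theorem integrable_mul_laplacian (ha : ContDiff ℝ 2 a) (hc : HasCompactSupport a) :
    Integrable fun x => a x * Laplacian.laplacian a x :=
  (ha.continuous.mul (continuous_laplacian ha)).integrable_of_hasCompactSupport hc.mul_right

theorem integrable_mul_neg_laplacian_add
    (hW : ∀ K : Set E, IsCompact K → K ⊆ Ω → MemLp W ∞ (volume.restrict K))
    (ha : ContDiff ℝ 2 a) (hc : HasCompactSupport a) (hsupp : tsupport a ⊆ Ω) :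
    Integrable fun x => a x * (-Laplacian.laplacian a x + W x * a x) := by
  refine ((integrable_mul_laplacian ha hc).neg.add
    (integrable_mul_of_forall_memLp_top hW (ha.continuous.mul ha.continuous) hc.mul_left
      (tsupport_mul_subset_left.trans hsupp))).congr (Eventually.of_forall fun x => ?_)
  simp only [Pi.add_apply, Pi.neg_apply, Pi.mul_apply]
  ring

theorem integral_mul_neg_laplacian_add
    (hW : ∀ K : Set E, IsCompact K → K ⊆ Ω → MemLp W ∞ (volume.restrict K))
    (ha : ContDiff ℝ 2 a) (hc : HasCompactSupport a) (hsupp : tsupport a ⊆ Ω) :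
    ∫ x, a x * (-Laplacian.laplacian a x + W x * a x)
      = (∫ x, ‖gradient a x‖ ^ 2) + ∫ x, W x * (a x * a x) := by
  have hgreen := integral_inner_gradient_eq_neg_integral_mul_laplacian ha hc
    (.of_contDiff (ha.of_le one_le_two) hc)
  simp only [real_inner_self_eq_norm_sq] at hgreen
  rw [hgreen, neg_add_eq_sub, eq_sub_iff_add_eq, ← integral_add
    (integrable_mul_neg_laplacian_add hW ha hc hsupp) (integrable_mul_laplacian ha hc)]
  exact integral_congr_ae (Eventually.of_forall fun x => by ring)

theorem integral_sq_le_integral_mul_neg_laplacian_add (hΩ : IsOpen Ω) (hne : Ω ≠ univ)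
    (hball : HasExteriorBalls Ω ρ)
    (hW : ∀ K : Set E, IsCompact K → K ⊆ Ω → MemLp W ∞ (volume.restrict K))
    (hWρ : ∀ᵐ x ∂volume.restrict Ω, 1 ≤ hardyPotential Ω ρ x + W x)
    (ha : ContDiff ℝ 2 a) (hc : HasCompactSupport a) (hsupp : tsupport a ⊆ Ω) :
    ∫ x, a x ^ 2 ≤ ∫ x, a x * (-Laplacian.laplacian a x + W x * a x) := by
  have hcont : Continuous fun x => a x * a x := ha.continuous.mul ha.continuous
  have hcs : HasCompactSupport fun x => a x * a x := hc.mul_left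
  have hsupp' : tsupport (fun x => a x * a x) ⊆ Ω := tsupport_mul_subset_left.trans hsupp
  have hhardy := integral_hardyPotential_mul_sq_le hΩ hne hball
    (.of_contDiff (ha.of_le one_le_two) hc) hsupp
  simp only [sq (a _)] at hhardy ⊢
  have hH : Integrable fun x => hardyPotential Ω ρ x * (a x * a x) :=
    integrable_mul_of_integrableOn_tsupport
      (((continuousOn_hardyPotential hΩ hne).mono hsupp').integrableOn_compact hcs) hcont hcs
  have hWa := integrable_mul_of_forall_memLp_top hW hcont hcs hsupp'
  have hpointwise : ∀ᵐ x, a x * a x ≤ hardyPotential Ω ρ x * (a x * a x) + W x * (a x * a x) := by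
    filter_upwards [(ae_restrict_iff' hΩ.measurableSet).1 hWρ] with x hx
    by_cases hxΩ : x ∈ Ω
    · rw [← add_mul]
      exact le_mul_of_one_le_left (mul_self_nonneg _) (hx hxΩ)
    · simp [image_eq_zero_of_notMem_tsupport (notMem_subset hsupp hxΩ)]
  calc ∫ x, a x * a x
      ≤ ∫ x, (hardyPotential Ω ρ x * (a x * a x) + W x * (a x * a x)) :=
        integral_mono_ae (hcont.integrable_of_hasCompactSupport hcs) (hH.add hWa) hpointwise
    _ = (∫ x, hardyPotential Ω ρ x * (a x * a x)) + ∫ x, W x * (a x * a x) :=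
        integral_add hH hWa
    _ ≤ (∫ x, ‖gradient a x‖ ^ 2) + ∫ x, W x * (a x * a x) := by gcongr
    _ = _ := (integral_mul_neg_laplacian_add hW ha hc hsupp).symm

end Coercivity

section TestFunctions

variable {E F F' : Type*} [NormedAddCommGroup F] [NormedSpace ℝ F]

section NormedSpace

variable [NormedAddCommGroup E] [NormedSpace ℝ E] {Ω : Opens E}

theorem testFunction_contDiff_two (φ : 𝓓(Ω, F)) : ContDiff ℝ 2 φ :=
  φ.contDiff.of_le (WithTop.coe_le_coe.2 le_top)

theorem testFunction_eq_zero_of_notMem (φ : 𝓓(Ω, F)) {x : E} (hx : x ∉ (Ω : Set E)) : φ x = 0 :=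
  image_eq_zero_of_notMem_tsupport (notMem_subset φ.tsupport_subset hx)

end NormedSpace

variable [NormedAddCommGroup E] [InnerProductSpace ℝ E] [FiniteDimensional ℝ E]
  [NormedAddCommGroup F'] [NormedSpace ℝ F'] {Ω : Opens E}

theorem laplacian_postcompCLM (T : F →L[ℝ] F') (φ : 𝓓(Ω, F)) (x : E) :
    Laplacian.laplacian (TestFunction.postcompCLM T φ : E → F') x
      = T (Laplacian.laplacian (φ : E → F) x) :=
  (testFunction_contDiff_two φ).contDiffAt.laplacian_CLM_comp_left

theorem integral_mul_laplacian_testFunction [MeasurableSpace E] [BorelSpace E] (φ ψ : 𝓓(Ω, ℂ)) :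
    ∫ x, φ x * Laplacian.laplacian (ψ : E → ℂ) x
      = ∫ x, Laplacian.laplacian (φ : E → ℂ) x * ψ x := by
  have h := SchwartzMap.integral_mul_laplacian_right_eq_left (μ := volume)
    (φ.hasCompactSupport.toSchwartzMap φ.contDiff) (ψ.hasCompactSupport.toSchwartzMap ψ.contDiff)
  simp only [SchwartzMap.laplacian_apply] at h
  exact h

theorem setIntegral_inner_laplacian_testFunction [MeasurableSpace E] [BorelSpace E]
    (φ ψ : 𝓓(Ω, ℂ)) :
    ∫ x in (Ω : Set E), inner ℂ (φ x) (Laplacian.laplacian (ψ : E → ℂ) x)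
      = ∫ x in (Ω : Set E), inner ℂ (Laplacian.laplacian (φ : E → ℂ) x) (ψ x) := by
  rw [setIntegral_eq_integral_of_forall_compl_eq_zero fun x hx => by
      rw [testFunction_eq_zero_of_notMem φ hx, inner_zero_left],
    setIntegral_eq_integral_of_forall_compl_eq_zero fun x hx => by
      rw [testFunction_eq_zero_of_notMem ψ hx, inner_zero_right]]
  have h := integral_mul_laplacian_testFunction
    (TestFunction.postcompCLM (Complex.conjCLE : ℂ →L[ℝ] ℂ) φ) ψ
  simp only [laplacian_postcompCLM] at h
  simp only [TestFunction.postcompCLM_apply, Function.comp_apply,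
    ContinuousLinearEquiv.coe_coe, Complex.conjCLE_apply] at h
  simpa only [RCLike.inner_apply, mul_comm] using h

end TestFunctions

section InnerProduct

variable {X : Type*} [MeasurableSpace X] {μ : Measure X} {f g : X → ℂ}

theorem inner_toLp_eq_integral (hf : MemLp f 2 μ) (hg : MemLp g 2 μ) :
    inner ℂ (hf.toLp f) (hg.toLp g) = ∫ x, inner ℂ (f x) (g x) ∂μ := by
  rw [L2.inner_def]
  refine integral_congr_ae ?_
  filter_upwards [hf.coeFn_toLp, hg.coeFn_toLp] with x hfx hgx
  rw [hfx, hgx]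

theorem integrable_inner_of_memLp (hf : MemLp f 2 μ) (hg : MemLp g 2 μ) :
    Integrable (fun x => inner ℂ (f x) (g x)) μ := by
  refine (L2.integrable_inner (𝕜 := ℂ) (hf.toLp f) (hg.toLp g)).congr ?_
  filter_upwards [hf.coeFn_toLp, hg.coeFn_toLp] with x hfx hgx
  rw [hfx, hgx]

end InnerProduct

section Schrodinger

variable {n : ℕ} {Ω : Opens (EuclideanSpace ℝ (Fin n))} {V W : EuclideanSpace ℝ (Fin n) → ℝ}

theorem LocallyLInfty.sub_const (hV : LocallyLInfty Ω V) (e : ℝ) :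
    LocallyLInfty Ω fun x => V x - e := fun K hK hKΩ =>
  have : IsFiniteMeasure (volume.restrict K) := isFiniteMeasure_restrict.2 hK.measure_ne_top
  (hV K hK hKΩ).sub (memLp_const e)

theorem schrodingerMap_sub_smul (hV : LocallyLInfty Ω V) (e : ℝ) (φ : 𝓓(Ω, ℂ)) :
    schrodingerMap hV φ - (e : ℂ) • testToL2 Ω φ = schrodingerMap (hV.sub_const e) φ := by
  change (schrodingerFun_memLp hV φ).toLp _ - (e : ℂ) • (testFunction_memLp φ).toLp _
    = (schrodingerFun_memLp (hV.sub_const e) φ).toLp _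
  rw [← MemLp.toLp_const_smul, ← MemLp.toLp_sub]
  congr 1
  funext x
  simp only [schrodingerFun, Pi.sub_apply, Pi.smul_apply, smul_eq_mul, Complex.ofReal_sub]
  ring

theorem schrodingerOp_isFormalAdjoint (hV : LocallyLInfty Ω V) :
    (schrodingerOp Ω V hV).IsFormalAdjoint (schrodingerOp Ω V hV) := by
  rintro ⟨_, φ, rfl⟩ ⟨_, ψ, rfl⟩
  have hφ := testFunction_memLp φ
  have hψ := testFunction_memLp ψ
  have hHφ := schrodingerFun_memLp hV φ
  have hHψ := schrodingerFun_memLp hV ψ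
  rw [schrodingerOp_apply, schrodingerOp_apply]
  change inner ℂ (hHφ.toLp _) (hψ.toLp _) = inner ℂ (hφ.toLp _) (hHψ.toLp _)
  rw [inner_toLp_eq_integral, inner_toLp_eq_integral, ← sub_eq_zero,
    ← integral_sub (integrable_inner_of_memLp hHφ hψ) (integrable_inner_of_memLp hφ hHψ)]
  have hpotential (x) : inner ℂ (schrodingerFun V φ x) (ψ x) - inner ℂ (φ x) (schrodingerFun V ψ x)
      = inner ℂ (φ x) (Laplacian.laplacian (ψ : EuclideanSpace ℝ (Fin n) → ℂ) x)
        - inner ℂ (Laplacian.laplacian (φ : EuclideanSpace ℝ (Fin n) → ℂ) x) (ψ x) := by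
    simp only [schrodingerFun, RCLike.inner_apply, map_add, map_neg, map_mul, Complex.conj_ofReal]
    ring
  simp only [hpotential]
  rw [integral_sub (integrable_inner_of_memLp hφ (testFunction_laplacian_memLp ψ))
    (integrable_inner_of_memLp (testFunction_laplacian_memLp φ) hψ),
    setIntegral_inner_laplacian_testFunction, sub_self]

theorem schrodingerFun_postcompCLM_ofReal (θ : 𝓓(Ω, ℝ)) (x : EuclideanSpace ℝ (Fin n)) :
    schrodingerFun W (TestFunction.postcompCLM Complex.ofRealCLM θ) x
      = ((-Laplacian.laplacian (θ : EuclideanSpace ℝ (Fin n) → ℝ) x + W x * θ x : ℝ) : ℂ) := by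
  rw [schrodingerFun, laplacian_postcompCLM]
  simp

theorem denseRange_testToL2 (Ω : Opens (EuclideanSpace ℝ (Fin n))) : DenseRange (testToL2 Ω) := by
  refine denseRange_of_forall_inner_eq_zero (testToL2 Ω) fun ψ hψ => ?_
  have hloc : LocallyIntegrableOn ψ (Ω : Set (EuclideanSpace ℝ (Fin n))) := by
    refine (locallyIntegrableOn_iff Ω.isOpen.isLocallyClosed).2 fun K hKΩ hK => ?_
    have : IsFiniteMeasure (volume.restrict K) := isFiniteMeasure_restrict.2 hK.measure_ne_top
    exact ((Lp.memLp ψ).mono_measure (Measure.restrict_mono hKΩ le_rfl)).integrable one_le_two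
  have hψ0 := Ω.isOpen.ae_eq_zero_of_integral_contDiff_smul_eq_zero hloc fun θ hθ hc hs => ?_
  · rw [Lp.eq_zero_iff_ae_eq_zero]
    exact (ae_restrict_iff' Ω.isOpen.measurableSet).2 hψ0
  · let φ : 𝓓(Ω, ℂ) := TestFunction.postcompCLM Complex.ofRealCLM ⟨θ, hθ, hc, hs⟩
    have hφ := inner_eq_zero_symm.1 (hψ φ)
    rw [L2.inner_def] at hφ
    rw [← setIntegral_eq_integral_of_forall_compl_eq_zero fun x hx => by
      rw [image_eq_zero_of_notMem_tsupport (notMem_subset hs hx), zero_smul], ← hφ]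
    refine integral_congr_ae ?_
    filter_upwards [(testFunction_memLp φ).coeFn_toLp] with x hx
    change _ = inner ℂ ((testFunction_memLp φ).toLp φ x) (ψ x)
    rw [hx, RCLike.inner_apply]
    simp [φ, mul_comm]

theorem memLp_neg_laplacian_add (hW : LocallyLInfty Ω W) (θ : 𝓓(Ω, ℝ)) :
    MemLp (fun x => -Laplacian.laplacian (θ : EuclideanSpace ℝ (Fin n) → ℝ) x + W x * θ x) 2
      (volume.restrict (Ω : Set (EuclideanSpace ℝ (Fin n)))) := by
  have h := (schrodingerFun_memLp hW (TestFunction.postcompCLM Complex.ofRealCLM θ)).re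
  simpa only [schrodingerFun_postcompCLM_ofReal, RCLike.re_eq_complex_re,
    Complex.ofReal_re] using h

theorem isWeakSolution_indicator (hW : LocallyLInfty Ω W) {v : EuclideanSpace ℝ (Fin n) → ℝ}
    (hv : MemLp v 2 (volume.restrict (Ω : Set (EuclideanSpace ℝ (Fin n)))))
    (h : ∀ θ : 𝓓(Ω, ℝ), ∫ x in (Ω : Set (EuclideanSpace ℝ (Fin n))),
      v x * (-Laplacian.laplacian (θ : EuclideanSpace ℝ (Fin n) → ℝ) x + W x * θ x) = 0) :
    IsWeakSolution (Ω : Set (EuclideanSpace ℝ (Fin n))) W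
      ((Ω : Set (EuclideanSpace ℝ (Fin n))).indicator v) := by
  intro θ hθ hc hs
  have hH := hv.integrable_mul (memLp_neg_laplacian_add hW ⟨θ, hθ, hc, hs⟩)
  have hΔ := hv.integrable_mul (q := 2) (((continuous_laplacian (hθ.of_le
    (WithTop.coe_le_coe.2 le_top))).memLp_of_hasCompactSupport
    (hasCompactSupport_laplacian hc)).restrict _)
  have hindicator (g : EuclideanSpace ℝ (Fin n) → ℝ) :
      ∫ x, (Ω : Set (EuclideanSpace ℝ (Fin n))).indicator v x * g x
        = ∫ x in (Ω : Set (EuclideanSpace ℝ (Fin n))), v x * g x := by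
    rw [← integral_indicator Ω.isOpen.measurableSet]
    simp only [indicator_mul_left]
  rw [hindicator, hindicator, ← zero_add (∫ x in _, v x * Laplacian.laplacian θ x),
    ← h ⟨θ, hθ, hc, hs⟩]
  refine (integral_add hH hΔ).symm.trans (integral_congr_ae (Eventually.of_forall fun x => ?_))
  change v x * (-Laplacian.laplacian θ x + W x * θ x) + v x * Laplacian.laplacian θ x = _
  ring

theorem isWeakSolution_indicator_of_inner_eq_zero (hW : LocallyLInfty Ω W) {ψ : L2 Ω}
    (hψ : ∀ φ, inner ℂ ψ (schrodingerMap hW φ) = 0) (l : ℂ →L[ℝ] ℝ) :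
    IsWeakSolution (Ω : Set (EuclideanSpace ℝ (Fin n))) W
      ((Ω : Set (EuclideanSpace ℝ (Fin n))).indicator fun x => l (ψ x)) := by
  refine isWeakSolution_indicator hW (l.comp_memLp' (Lp.memLp ψ)) fun θ => ?_
  let φ := TestFunction.postcompCLM Complex.ofRealCLM θ
  have hφ := inner_eq_zero_symm.1 (hψ φ)
  have hint := L2.integrable_inner (𝕜 := ℂ) (schrodingerMap hW φ) ψ
  rw [L2.inner_def] at hφ
  rw [← map_zero l, ← hφ, ← l.integral_comp_comm hint]
  refine integral_congr_ae ?_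
  filter_upwards [(schrodingerFun_memLp hW φ).coeFn_toLp] with x hx
  change _ = l (inner ℂ ((schrodingerFun_memLp hW φ).toLp _ x) (ψ x))
  rw [hx, schrodingerFun_postcompCLM_ofReal, RCLike.inner_apply, Complex.conj_ofReal,
    mul_comm (ψ x), ← Complex.real_smul, map_smul, smul_eq_mul, mul_comm]

theorem eq_zero_of_inner_schrodingerMap_eq_zero {ρ : ℝ} {G : ℝ → ℝ} (hW : LocallyLInfty Ω W)
    (hne : (Ω : Set (EuclideanSpace ℝ (Fin n))) ≠ univ)
    (hbdd : Bornology.IsBounded (Ω : Set (EuclideanSpace ℝ (Fin n))))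
    (hball : HasExteriorBalls (Ω : Set (EuclideanSpace ℝ (Fin n))) ρ) (hG : ConditionSigma G)
    (hWG : ∀ᵐ x ∂volume.restrict (Ω : Set (EuclideanSpace ℝ (Fin n))),
      deriv G (Metric.infDist x (Ω : Set (EuclideanSpace ℝ (Fin n)))ᶜ) ^ 2 + 1
        ≤ hardyPotential (Ω : Set (EuclideanSpace ℝ (Fin n))) ρ x + W x) {ψ : L2 Ω}
    (hψ : ∀ φ, inner ℂ ψ (schrodingerMap hW φ) = 0) : ψ = 0 := by
  have hzero (l : ℂ →L[ℝ] ℝ) :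
      ∀ᵐ x ∂volume.restrict (Ω : Set (EuclideanSpace ℝ (Fin n))), l (ψ x) = 0 := by
    have h := (isWeakSolution_indicator_of_inner_eq_zero hW hψ l).ae_eq_zero Ω.isOpen hne hbdd hball
      ((memLp_indicator_iff_restrict Ω.isOpen.measurableSet).2 (l.comp_memLp' (Lp.memLp ψ)))
      (fun x hx => indicator_of_notMem hx _) hW hG hWG
    filter_upwards [ae_restrict_of_ae h, ae_restrict_mem Ω.isOpen.measurableSet] with x hx hxΩ
    rwa [indicator_of_mem hxΩ] at hx
  rw [Lp.eq_zero_iff_ae_eq_zero]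
  filter_upwards [hzero Complex.reCLM, hzero Complex.imCLM] with x hre him
  exact Complex.ext hre him

theorem re_inner_testToL2_toLp (φ : 𝓓(Ω, ℂ)) {g : EuclideanSpace ℝ (Fin n) → ℂ}
    (hg : MemLp g 2 (volume.restrict (Ω : Set (EuclideanSpace ℝ (Fin n))))) :
    (inner ℂ (testToL2 Ω φ) (hg.toLp g)).re
      = ∫ x, ((φ x).re * (g x).re + (φ x).im * (g x).im) := by
  change RCLike.re (inner ℂ ((testFunction_memLp φ).toLp φ) (hg.toLp g)) = _
  rw [inner_toLp_eq_integral, ← integral_re (integrable_inner_of_memLp (testFunction_memLp φ) hg)]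
  refine Eq.trans (integral_congr_ae (Eventually.of_forall fun x => ?_))
    (setIntegral_eq_integral_of_forall_compl_eq_zero fun x hx => ?_)
  · simp [mul_comm]
  · simp [testFunction_eq_zero_of_notMem φ hx]

theorem norm_testToL2_sq (φ : 𝓓(Ω, ℂ)) :
    ‖testToL2 Ω φ‖ ^ 2 = ∫ x, ((φ x).re ^ 2 + (φ x).im ^ 2) := by
  rw [← inner_self_eq_norm_sq (𝕜 := ℂ)]
  simp only [sq]
  exact re_inner_testToL2_toLp φ (testFunction_memLp φ)

theorem re_inner_testToL2_schrodingerMap (hW : LocallyLInfty Ω W) (φ : 𝓓(Ω, ℂ)) :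
    (inner ℂ (testToL2 Ω φ) (schrodingerMap hW φ)).re
      = ∫ x, ((φ x).re * (-(Laplacian.laplacian (φ : EuclideanSpace ℝ (Fin n) → ℂ) x).re
            + W x * (φ x).re)
          + (φ x).im * (-(Laplacian.laplacian (φ : EuclideanSpace ℝ (Fin n) → ℂ) x).im
            + W x * (φ x).im)) := by
  refine (re_inner_testToL2_toLp φ (schrodingerFun_memLp hW φ)).trans ?_
  simp [schrodingerFun]

theorem norm_testToL2_sq_le {ρ : ℝ} (hW : LocallyLInfty Ω W)
    (hne : (Ω : Set (EuclideanSpace ℝ (Fin n))) ≠ univ)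
    (hball : HasExteriorBalls (Ω : Set (EuclideanSpace ℝ (Fin n))) ρ)
    (hWρ : ∀ᵐ x ∂volume.restrict (Ω : Set (EuclideanSpace ℝ (Fin n))),
      1 ≤ hardyPotential (Ω : Set (EuclideanSpace ℝ (Fin n))) ρ x + W x) (φ : 𝓓(Ω, ℂ)) :
    ‖testToL2 Ω φ‖ ^ 2 ≤ (inner ℂ (testToL2 Ω φ) (schrodingerMap hW φ)).re := by
  have hcont (a : 𝓓(Ω, ℝ)) : Integrable fun x => a x ^ 2 := by
    simp only [sq]
    exact (a.continuous.mul a.continuous).integrable_of_hasCompactSupport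
      a.hasCompactSupport.mul_left
  have hint (a : 𝓓(Ω, ℝ)) := integrable_mul_neg_laplacian_add hW (testFunction_contDiff_two a)
    a.hasCompactSupport a.tsupport_subset
  have hreal (a : 𝓓(Ω, ℝ)) := integral_sq_le_integral_mul_neg_laplacian_add Ω.isOpen hne hball hW
    hWρ (testFunction_contDiff_two a) a.hasCompactSupport a.tsupport_subset
  let a := TestFunction.postcompCLM Complex.reCLM φ
  let b := TestFunction.postcompCLM Complex.imCLM φ
  rw [norm_testToL2_sq, re_inner_testToL2_schrodingerMap]
  calc ∫ x, ((φ x).re ^ 2 + (φ x).im ^ 2)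
      = (∫ x, a x ^ 2) + ∫ x, b x ^ 2 := integral_add (hcont a) (hcont b)
    _ ≤ _ := add_le_add (hreal a) (hreal b)
    _ = _ := (integral_add (hint a) (hint b)).symm
    _ = _ := by simp only [a, b, laplacian_postcompCLM]; rfl

theorem isEssentiallySelfAdjoint_schrodingerOp_of_sub_const (hV : LocallyLInfty Ω V) (e : ℝ)
    (hco : ∀ φ, ‖testToL2 Ω φ‖ ^ 2
      ≤ (inner ℂ (testToL2 Ω φ) (schrodingerMap (hV.sub_const e) φ)).re)
    (hker : ∀ ψ, (∀ φ, inner ℂ ψ (schrodingerMap (hV.sub_const e) φ) = 0) → ψ = 0) :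
    IsEssentiallySelfAdjoint (schrodingerOp Ω V hV) := by
  have hshift (φ : 𝓓(Ω, ℂ)) :
      schrodingerOp Ω V hV ⟨testToL2 Ω φ, LinearMap.mem_range_self _ φ⟩ - (e : ℂ) • testToL2 Ω φ
        = schrodingerMap (hV.sub_const e) φ := by
    rw [schrodingerOp_apply, schrodingerMap_sub_smul]
  refine isEssentiallySelfAdjoint_of_coercive (denseRange_testToL2 Ω)
    (schrodingerOp_isFormalAdjoint hV) (e := e) ?_ fun ψ hψ => hker ψ fun φ => ?_
  · rintro ⟨_, φ, rfl⟩
    rw [hshift]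
    exact hco φ
  · rw [← hshift]
    exact hψ _

end Schrodinger

theorem exists_ae_neg_le_of_memLp_top {α : Type*} [MeasurableSpace α] {μ : Measure α} {f : α → ℝ}
    (hf : MemLp f ∞ μ) : ∃ M : ℝ, ∀ᵐ x ∂μ, -M ≤ f x := by
  refine ⟨(eLpNorm f ∞ μ).toReal, ?_⟩
  filter_upwards [ae_le_eLpNormEssSup (f := f) (μ := μ)] with x hx
  rw [← eLpNorm_exponent_top] at hx
  have h := ENNReal.toReal_mono hf.eLpNorm_ne_top hx
  rw [toReal_enorm, Real.norm_eq_abs] at h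
  linarith [neg_abs_le (f x)]

theorem exists_ae_sub_le_add_of_memLp_top {α : Type*} [MeasurableSpace α] {μ : Measure α}
    {f f₁ f₂ g h : α → ℝ} (hf : ∀ᵐ x ∂μ, f x = f₁ x + f₂ x) (hf₁ : ∀ᵐ x ∂μ, g x ≤ f₁ x + h x)
    (hf₂ : MemLp f₂ ∞ μ) : ∃ M : ℝ, ∀ᵐ x ∂μ, g x - M ≤ f x + h x := by
  obtain ⟨M, hM⟩ := exists_ae_neg_le_of_memLp_top hf₂
  refine ⟨M, ?_⟩
  filter_upwards [hf, hf₁, hM] with x hx h₁ h₂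
  linarith

theorem ne_univ_of_isBounded {n : ℕ} (hn : 1 ≤ n) {s : Set (EuclideanSpace ℝ (Fin n))}
    (hs : Bornology.IsBounded s) : s ≠ univ := fun h =>
  have : Nonempty (Fin n) := ⟨⟨0, hn⟩⟩
  NormedSpace.unbounded_univ ℝ (EuclideanSpace ℝ (Fin n)) (h ▸ hs)

theorem theorem1_general {n : ℕ} (Ω : Opens (EuclideanSpace ℝ (Fin n)))
    (hbdd : Bornology.IsBounded (Ω : Set (EuclideanSpace ℝ (Fin n))))
    (hne : (Ω : Set (EuclideanSpace ℝ (Fin n))) ≠ univ) {ρ : ℝ}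
    (hball : HasExteriorBalls (Ω : Set (EuclideanSpace ℝ (Fin n))) ρ)
    (V : EuclideanSpace ℝ (Fin n) → ℝ) (hV : LocallyLInfty Ω V)
    (G : ℝ → ℝ) (hG : ConditionSigma G) (M : ℝ)
    (hVM : ∀ᵐ x ∂volume.restrict (Ω : Set (EuclideanSpace ℝ (Fin n))),
      (deriv G (bdryDist Ω x)) ^ 2 - M ≤ V x + 1 / 4 * (1 / (bdryDist Ω x) ^ 2)) :
    IsEssentiallySelfAdjoint (schrodingerOp Ω V hV) := by
  set e : ℝ := -(3 / 4 * (n / ρ) ^ 2 + M + 1) with he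
  have hVG : ∀ᵐ x ∂volume.restrict (Ω : Set (EuclideanSpace ℝ (Fin n))),
      deriv G (Metric.infDist x (Ω : Set (EuclideanSpace ℝ (Fin n)))ᶜ) ^ 2 + 1
        ≤ hardyPotential (Ω : Set (EuclideanSpace ℝ (Fin n))) ρ x + (V x - e) := by
    filter_upwards [hVM, ae_restrict_mem Ω.isOpen.measurableSet] with x hx hxΩ
    rw [bdryDist_eq_infDist_compl hne hxΩ] at hx
    simp only [hardyPotential, finrank_euclideanSpace_fin, he]
    linarith
  have hV1 : ∀ᵐ x ∂volume.restrict (Ω : Set (EuclideanSpace ℝ (Fin n))),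
      1 ≤ hardyPotential (Ω : Set (EuclideanSpace ℝ (Fin n))) ρ x + (V x - e) :=
    hVG.mono fun x hx => (le_add_of_nonneg_left (sq_nonneg _)).trans hx
  exact isEssentiallySelfAdjoint_schrodingerOp_of_sub_const hV e
    (norm_testToL2_sq_le (hV.sub_const e) hne hball hV1)
    fun ψ => eq_zero_of_inner_schrodingerMap_eq_zero (hV.sub_const e) hne hbdd hball hG hVG

theorem theorem1 {n : ℕ} (hn : 1 ≤ n) (Ω : Opens (EuclideanSpace ℝ (Fin n)))
    (hbdd : Bornology.IsBounded (Ω : Set (EuclideanSpace ℝ (Fin n))))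
    (hC2 : HasC2Boundary Ω)
    (V V₁ V₂ : EuclideanSpace ℝ (Fin n) → ℝ) (hV : LocallyLInfty Ω V)
    (hsum : ∀ᵐ x ∂volume.restrict (Ω : Set (EuclideanSpace ℝ (Fin n))), V x = V₁ x + V₂ x)
    (G : ℝ → ℝ) (hG : ConditionSigma G)
    (hV₁ : ∀ᵐ x ∂volume.restrict (Ω : Set (EuclideanSpace ℝ (Fin n))),
      (deriv G (bdryDist Ω x)) ^ 2 ≤ V₁ x + 1 / 4 * (1 / (bdryDist Ω x) ^ 2))
    (hV₂ : MemLp V₂ ∞ (volume.restrict (Ω : Set (EuclideanSpace ℝ (Fin n))))) :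
    IsEssentiallySelfAdjoint (schrodingerOp Ω V hV) := by
  obtain ⟨ρ, hball⟩ := hC2.exists_hasExteriorBalls hbdd
  obtain ⟨M, hM⟩ := exists_ae_sub_le_add_of_memLp_top hsum hV₁ hV₂
  exact theorem1_general Ω hbdd (ne_univ_of_isBounded hn hbdd) hball V hV G hG M hM
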